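/- **Theorem 2.9 (Linear hyperbolic equation).** Let $H$ be a real Hilbert space, and let $A$ be a self-adjoint (possibly unbounded) linear operator on $H$ with dense domain $D(A)$. Assume that $A$ is coercive: there is $\nu>0$ such that $\langle Ax,x\rangle\ge \nu|x|^2$ for every $x\in D(A)$ (for $H\neq\{0\}$ the best choice is $\nu=\inf\{\langle Ax,x\rangle : x\in D(A),\ |x|=1\}$). Let $A^{1/2}$ be the nonnegative self-adjoint square root of $A$, and let $D(A)$ and $D(A^{1/2})$ carry the graph norms. Let $p\in[0,1]$, $(u_0,u_1)\in D(A)\times D(A^{1/2})$ and $\varepsilon_0>0$. For $\varepsilon\in(0,\varepsilon_0)$ let $c_\varepsilon:[0,+\infty)\to(0,+\infty)$ be functions of class $C^1$, and assume that there are constants $\mu>0$, $M_3$, $M_4$, independent of $\varepsilon$, such that $$\mu\le c_\varepsilon(t)\le M_3,\qquad |c_\varepsilon'(t)|\le \frac{M_4}{(1+t)^p}\qquad \forall t\ge 0,\ \forall\varepsilon\in(0,\varepsilon_0).$$ Then for every $\varepsilon\in(0,\varepsilon_0)$ the Cauchy problem $$\varepsilon u_\varepsilon''(t)+\frac{1}{(1+t)^p}u_\varepsilon'(t)+c_\varepsilon(t)Au_\varepsilon(t)=0\quad\forall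 t\ge0,\qquad u_\varepsilon(0)=u_0,\quad u_\varepsilon'(0)=u_1,$$ has a unique global solution $$u_\varepsilon\in C^2([0,+\infty);H)\cap C^1([0,+\infty);D(A^{1/2}))\cap C^0([0,+\infty);D(A)).$$ Moreover the function $$\Gamma_\varepsilon(t):=|u_\varepsilon(t)|^2+|A^{1/2}u_\varepsilon(t)|^2+|Au_\varepsilon(t)|^2+|u_\varepsilon'(t)|^2+\varepsilon|A^{1/2}u_\varepsilon'(t)|^2$$ satisfies the following decay estimates. - Case $p=0$: for every $\beta<2\mu\nu$ there exist $\varepsilon_1\in(0,\varepsilon_0]$ and $C$ such that $\Gamma_\varepsilon(t)\le Ce^{-\beta t}$ for every $t\ge0$ and every $\varepsilon\in(0,\varepsilon_1)$. - Case $p\in(0,1)$: for every $\beta>0$ there exist $\varepsilon_1\in(0,\varepsilon_0]$ and $C$ such that $\Gamma_\varepsilon(t)\le Ce^{-\beta(1+t)^{1-p}}$ for every $t\ge0$ and every $\varepsilon\in(0,\varepsilon_1)$. - Case $p=1$: for every $\beta>0$ there exist $\varepsilon_1\in(0,\varepsilon_0]$ and $C$ such that $\Gamma_\varepsilon(t)\le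 C(1+t)^{-\beta}$ for every $t\ge0$ and every $\varepsilon\in(0,\varepsilon_1)$. The constants $\varepsilon_1$ and $C$ may depend on $\beta$, but not on $\varepsilon$ and $t$. -/

import Mathlib

open Set

noncomputable section

namespace HypParab

variable {H : Type*} [NormedAddCommGroup H] [InnerProductSpace ℝ H]

/-- The value `A x` of an unbounded operator, extended by `0` outside of its domain. -/
def opVal (A : H →ₗ.[ℝ] H) (x : H) : H :=
  open Classical in if h : x ∈ A.domain then A ⟨x, h⟩ else 0

/-- `B` is a nonnegative self-adjoint operator with `B ∘ B = A` as unbounded operators: a point `x`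
lies in the domain of `A` if and only if `x` and `B x` lie in the domain of `B`, and then
`A x = B (B x)`. Every nonnegative self-adjoint `A` has exactly one such `B`. -/
structure IsNonnegSqrt [CompleteSpace H] (A B : H →ₗ.[ℝ] H) : Prop where
  selfAdjoint : IsSelfAdjoint B
  nonneg : ∀ x : B.domain, 0 ≤ inner ℝ (B x) (x : H)
  comp_self : ∀ x y : H, (x, y) ∈ A.graph ↔ ∃ z, (x, z) ∈ B.graph ∧ (z, y) ∈ B.graph

/-- The square root `A^{1/2}` of a nonnegative self-adjoint operator `A`, that is, its unique
nonnegative self-adjoint square root (with a junk value for operators without a square root). -/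
def sqrtOp [CompleteSpace H] (A : H →ₗ.[ℝ] H) : H →ₗ.[ℝ] H :=
  open Classical in if h : ∃ B, IsNonnegSqrt A B then h.choose else ⊥

/-- `u ∈ C^k([0, ∞); D(B))`, where `D(B)` carries the graph norm of `B`. The space `D(B)` with the
graph norm is the graph of `B`, as a normed subspace of `H × H`. -/
def ContDiffIntoDomain (k : ℕ) (B : H →ₗ.[ℝ] H) (u : ℝ → H) : Prop :=
  ∃ U : ℝ → B.graph, ContDiffOn ℝ k U (Ici 0) ∧ ∀ t ∈ Ici (0 : ℝ), (U t : H × H).1 = u t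

/-- `u' (t)` on the half line `[0, ∞)` (one-sided at `t = 0`). -/
def deriv₁ (u : ℝ → H) (t : ℝ) : H := derivWithin u (Ici 0) t

/-- `u'' (t)` on the half line `[0, ∞)` (one-sided at `t = 0`). -/
def deriv₂ (u : ℝ → H) (t : ℝ) : H := derivWithin (deriv₁ u) (Ici 0) t

/-- `u` is a global solution of the Cauchy problem
`ε u'' + (1 + t)^{-p} u' + c(t) A u = 0` for `t ≥ 0`, `u(0) = u₀`, `u'(0) = u₁`, of class
`C²([0, ∞); H) ∩ C¹([0, ∞); D(A^{1/2})) ∩ C⁰([0, ∞); D(A))`.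
Only the values of `u` on `[0, ∞)` matter. -/
structure IsGlobalSolution [CompleteSpace H] (A : H →ₗ.[ℝ] H) (p ε : ℝ) (c : ℝ → ℝ) (u₀ u₁ : H)
    (u : ℝ → H) : Prop where
  contDiff_two : ContDiffOn ℝ 2 u (Ici 0)
  contDiff_one : ContDiffIntoDomain 1 (sqrtOp A) u
  contDiff_zero : ContDiffIntoDomain 0 A u
  equation : ∀ t, 0 ≤ t →
    ε • deriv₂ u t + (1 / (1 + t) ^ p) • deriv₁ u t + c t • opVal A (u t) = 0
  init : u 0 = u₀
  init_deriv : deriv₁ u 0 = u₁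

/-- `Γ_ε(t) = |u|² + |A^{1/2} u|² + |A u|² + |u'|² + ε |A^{1/2} u'|²`, evaluated at time `t`. -/
def Gam [CompleteSpace H] (A : H →ₗ.[ℝ] H) (ε : ℝ) (u : ℝ → H) (t : ℝ) : ℝ :=
  ‖u t‖ ^ 2 + ‖opVal (sqrtOp A) (u t)‖ ^ 2 + ‖opVal A (u t)‖ ^ 2 + ‖deriv₁ u t‖ ^ 2
    + ε * ‖opVal (sqrtOp A) (deriv₁ u t)‖ ^ 2

end HypParab

end

/-! Since A ≥ ν > 0, A^{1/2} has a bounded symmetric injective inverse S, and the problem is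
rewritten for f = A u and g = A^{1/2} u'. With b(t) = (1+t)^{-p} it reads formally f' = A^{1/2} g, ε
g' = -b g - c A^{1/2} f. The rigorous version `IsMildPair` differentiates only S f and S g, with f
and g merely continuous. The five terms of Γ are then the norms of S S f, S f, f, S g and g.

Existence (`IsApprox.exists_isMildPair`): A^{1/2} is replaced by the bounded operators R_n = (S +
δ_n)^{-1} with δ_n → 0. Symmetry makes the estimate for ε|g|² + c|f|² independent of the size of
R_n, and the approximate solutions are Cauchy, uniformly on bounded time intervals. Uniqueness
(`IsMildPair.unique`) uses the same energy for S f and S g.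

Decay (`exists_energy_decay`): the energy E = ε|g|²/c + |f|² dissipates only through g. One adds l b
(2ε⟨h,g⟩ + b|h|²), where h approximates S f; its derivative contains -2 l b c |f|². For l large and
ε small the sum F is comparable with E and F' ≤ -β b F, so E decays like exp(-βΘ) with Θ' = b. The
one obstruction that does not vanish with ε is the term β l b³|h|², where |h|² is about |f|²/ν at
most: it requires β b² < 2μν for large times. This gives the threshold 2μν for p = 0 and no
restriction for p > 0, where b → 0. The three rates come from Θ = t, Θ = ((1+t)^{1-p} - 1)/(1-p) and
Θ = log(1+t).

Velocity (`IsMildPair.norm_velocity_sq_le`): E controls |g|² only with a factor ε, so |u'|² = |S g|²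
is bounded by treating ε u'' + b u' = -c f as a first order equation for u'. This divides f by b.
The loss of b² is recovered by running the energy estimate at rate β + 2, because b' ≥ -b² and b(0)
= 1 give b ≥ exp(-Θ). -/

noncomputable section

namespace HypParab

section Auxiliary

open Filter Topology

variable {H : Type*} [NormedAddCommGroup H] [InnerProductSpace ℝ H]

/-! ### Inverse and square root of a coercive self-adjoint operator. -/

/-- In a Banach algebra `1 - X` has a square root `1 - Y` with `‖Y‖ ≤ 1` if `‖X‖ ≤ 1`; moreover `Y`
lies in every closed set that is stable under `Z ↦ (X + Z ^ 2) / 2` and contains `0`. -/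
theorem exists_sqrt_one_sub {R : Type*} [NormedRing R] [NormedAlgebra ℝ R] [CompleteSpace R]
    (X : R) (hX : ‖X‖ ≤ 1) (s : Set R) (hs : IsClosed s) (h0 : (0 : R) ∈ s)
    (hstep : ∀ Z ∈ s, (1 / 2 : ℝ) • (X + Z * Z) ∈ s) :
    ∃ Y ∈ s, ‖Y‖ ≤ 1 ∧ (1 - Y) * (1 - Y) = 1 - X := by
  -- A fixed point Y = (X + Y²)/2 satisfies (1 - Y)² = 1 - X. The scalar iteration with X replaced
  -- by 1 increases and stays below 1; it dominates both the norms and the increments of `Y n`, and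
  -- its own increments telescope.
  let φ : R → R := fun Z => (1 / 2 : ℝ) • (X + Z * Z)
  let Y : ℕ → R := fun n => φ^[n] 0
  let ψ : ℝ → ℝ := fun z => (1 + z * z) / 2
  let a : ℕ → ℝ := fun n => ψ^[n] 0
  have hY : ∀ n, Y (n + 1) = (1 / 2 : ℝ) • (X + Y n * Y n) :=
    fun n => Function.iterate_succ_apply' φ n 0
  have ha : ∀ n, a (n + 1) = (1 + a n * a n) / 2 :=
    fun n => Function.iterate_succ_apply' ψ n 0
  have hYs : ∀ n, Y n ∈ s := by
    intro n
    induction n with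
    | zero => exact h0
    | succ n ih => rw [hY]; exact hstep _ ih
  have ha1 : ∀ n, 0 ≤ a n ∧ a n ≤ 1 := by
    intro n
    induction n with
    | zero => simp [a]
    | succ n ih => rw [ha]; constructor <;> nlinarith
  have hYa : ∀ n, ‖Y n‖ ≤ a n := by
    intro n
    induction n with
    | zero => simp [a, Y]
    | succ n ih =>
      rw [hY, ha, norm_smul]
      have h1 := norm_mul_le (Y n) (Y n)
      have h2 := norm_add_le X (Y n * Y n)
      have h3 : ‖Y n‖ * ‖Y n‖ ≤ a n * a n := mul_self_le_mul_self (norm_nonneg _) ih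
      norm_num
      linarith
  have hd : ∀ n, ‖Y (n + 1) - Y n‖ ≤ a (n + 1) - a n := by
    intro n
    induction n with
    | zero =>
      rw [hY, ha]
      simp only [Y, a, Function.iterate_zero, id, mul_zero, add_zero, sub_zero, norm_smul]
      norm_num
      linarith
    | succ n ih =>
      have e : Y (n + 1 + 1) - Y (n + 1) = (1 / 4 : ℝ) •
          ((Y (n + 1) - Y n) * (Y (n + 1) + Y n) + (Y (n + 1) + Y n) * (Y (n + 1) - Y n)) := by
        have e1 : (Y (n + 1) - Y n) * (Y (n + 1) + Y n) + (Y (n + 1) + Y n) * (Y (n + 1) - Y n)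
            = (2 : ℝ) • (Y (n + 1) * Y (n + 1) - Y n * Y n) := by
          rw [two_smul]; noncomm_ring
        rw [e1, smul_smul, hY (n + 1)]
        nth_rewrite 3 [hY n]
        rw [← smul_sub]
        norm_num
      have h1 := norm_mul_le (Y (n + 1) - Y n) (Y (n + 1) + Y n)
      have h2 := norm_mul_le (Y (n + 1) + Y n) (Y (n + 1) - Y n)
      have h3 := norm_add_le ((Y (n + 1) - Y n) * (Y (n + 1) + Y n))
        ((Y (n + 1) + Y n) * (Y (n + 1) - Y n))
      have h4 : ‖Y (n + 1) + Y n‖ ≤ a (n + 1) + a n :=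
        (norm_add_le _ _).trans (add_le_add (hYa _) (hYa _))
      have h5 : ‖Y (n + 1) - Y n‖ * ‖Y (n + 1) + Y n‖ ≤ (a (n + 1) - a n) * (a (n + 1) + a n) :=
        mul_le_mul ih h4 (norm_nonneg _) ((norm_nonneg _).trans ih)
      rw [e, norm_smul, ha (n + 1)]
      norm_num
      linarith [ha n]
  have hsum : Summable fun n => a (n + 1) - a n := by
    refine summable_of_sum_range_le (c := 1) (fun n => (norm_nonneg _).trans (hd n)) fun n => ?_
    rw [Finset.sum_range_sub]
    have := (ha1 n).2; have := (ha1 0).1; linarith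
  have hc : CauchySeq Y := cauchySeq_of_dist_le_of_summable _ (fun n => by
    rw [dist_comm, dist_eq_norm]; exact hd n) hsum
  obtain ⟨L, hL⟩ := cauchySeq_tendsto_of_complete hc
  have hfix : L = (1 / 2 : ℝ) • (X + L * L) := by
    refine tendsto_nhds_unique ((tendsto_add_atTop_iff_nat 1).2 hL) ?_
    simp_rw [hY]
    exact (tendsto_const_nhds.add (hL.mul hL)).const_smul _
  refine ⟨L, hs.mem_of_tendsto hL (Eventually.of_forall hYs),
    le_of_tendsto hL.norm (Eventually.of_forall fun n => (hYa n).trans (ha1 n).2), ?_⟩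
  have h2 : L + L = X + L * L := by
    have h := congrArg (fun Z => (2 : ℝ) • Z) hfix
    simpa [smul_smul, two_smul] using h
  calc (1 - L) * (1 - L) = 1 - (L + L) + L * L := by noncomm_ring
    _ = 1 - X := by rw [h2]; abel

section Operators

variable [CompleteSpace H]

/-- A coercive self-adjoint operator has a bounded everywhere defined inverse. -/
theorem exists_bounded_inverse (A : H →ₗ.[ℝ] H) (hdense : Dense (A.domain : Set H))
    (hA : IsSelfAdjoint A) (ν : ℝ) (hν : 0 < ν)
    (hcoer : ∀ x : A.domain, ν * ‖(x : H)‖ ^ 2 ≤ inner ℝ (A x) (x : H)) :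
    ∃ K : H →L[ℝ] H, ∀ x y : H, (x, y) ∈ A.graph ↔ x = K y := by
  have hgr : ∀ z : A.graph, ‖(z : H × H).1‖ ≤ (1 / ν) * ‖(z : H × H).2‖ := by
    rintro ⟨⟨x, y⟩, hz⟩
    obtain ⟨hx, hy⟩ : ∃ h : x ∈ A.domain, A ⟨x, h⟩ = y := by
      rw [LinearPMap.mem_graph_iff] at hz
      obtain ⟨w, hw, rfl⟩ := hz
      simp only at hw
      subst hw
      exact ⟨w.2, rfl⟩
    have h1 := hcoer ⟨x, hx⟩
    have h2 := real_inner_le_norm (A ⟨x, hx⟩) x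
    rw [hy] at h1 h2
    simp only at h1 ⊢
    rw [one_div, inv_mul_eq_div, le_div_iff₀ hν]
    rcases (norm_nonneg x).eq_or_lt with h | h
    · rw [← h]; simp
    · by_contra! hlt
      nlinarith
  have hclosed : IsClosed (A.graph : Set (H × H)) := hA.isClosed
  have : CompleteSpace A.graph := hclosed.completeSpace_coe
  let P : A.graph →L[ℝ] H := (ContinuousLinearMap.snd ℝ H H).comp A.graph.subtypeL
  -- Coercivity bounds x by A x on the graph, so the projection (x, A x) ↦ A x is injective with
  -- closed range. A vector orthogonal to the range lies in the kernel of A* = A, which is trivial.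
  have hanti : AntilipschitzWith (Real.toNNReal (max (1 / ν) 1)) P := by
    refine AddMonoidHomClass.antilipschitz_of_bound P fun z => ?_
    rw [Real.coe_toNNReal _ (by positivity)]
    change max ‖(z : H × H).1‖ ‖(z : H × H).2‖ ≤ max (1 / ν) 1 * ‖(z : H × H).2‖
    have h1 := hgr z
    have h0 := norm_nonneg (z : H × H).2
    refine max_le (h1.trans ?_) ?_
    · exact mul_le_mul_of_nonneg_right (le_max_left _ _) h0
    · nlinarith [le_max_right (1 / ν) 1]
  have hker : P.ker = ⊥ := LinearMap.ker_eq_bot.2 hanti.injective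
  have hcr : IsClosed (P.range : Set H) := hanti.isClosed_range P.uniformContinuous
  have hrange : P.range = ⊤ := by
    have : CompleteSpace P.range := hcr.completeSpace_coe
    rw [← Submodule.orthogonal_eq_bot_iff, Submodule.eq_bot_iff]
    intro y hy
    have hy' : ∀ x : A.domain, inner ℝ (A x) y = 0 := fun x =>
      (Submodule.mem_orthogonal _ _).1 hy _ ⟨⟨(x, A x), A.mem_graph x⟩, rfl⟩
    have hmem : (y, (0 : H)) ∈ A.graph := by
      have e : A.graph = A.graph.adjoint := by
        rw [← LinearPMap.adjoint_graph_eq_graph_adjoint hdense]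
        exact congrArg LinearPMap.graph (LinearPMap.isSelfAdjoint_def.1 hA).symm
      rw [e, Submodule.mem_adjoint_iff]
      intro a b hab
      rw [LinearPMap.mem_graph_iff] at hab
      obtain ⟨w, hw, rfl⟩ := hab
      simp [hy' w]
    have := hgr ⟨_, hmem⟩
    simpa using this
  let e : A.graph ≃L[ℝ] H := ContinuousLinearEquiv.ofBijective P hker hrange
  refine ⟨(ContinuousLinearMap.fst ℝ H H).comp (A.graph.subtypeL.comp (e.symm : H →L[ℝ] A.graph)),
    fun x y => ⟨fun h => ?_, fun h => ?_⟩⟩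
  · have : e.symm y = ⟨(x, y), h⟩ := by
      rw [ContinuousLinearEquiv.symm_apply_eq]; rfl
    simp [this]
  · have h2 : ((e.symm y : A.graph) : H × H).2 = y := e.apply_symm_apply y
    have h1 : ((e.symm y : A.graph) : H × H).1 = x := h.symm
    have := (e.symm y).2
    rwa [← Prod.mk.eta (p := ((e.symm y : A.graph) : H × H)), h1, h2] at this

/-- The inverse of an injective bounded symmetric operator is self-adjoint. -/
theorem isSelfAdjoint_of_graph_iff (B : H →ₗ.[ℝ] H) (S : H →L[ℝ] H)
    (hS : ∀ x y : H, inner ℝ (S x) y = inner ℝ x (S y))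
    (hB : ∀ x y : H, (x, y) ∈ B.graph ↔ x = S y) : IsSelfAdjoint B := by
  have hinj : ∀ y, S y = 0 → y = 0 := fun y h =>
    B.graph_fst_eq_zero_snd ((hB (S y) y).2 rfl) h
  have hdense : Dense (B.domain : Set H) := by
    rw [Submodule.dense_iff_topologicalClosure_eq_top, Submodule.topologicalClosure_eq_top_iff,
      Submodule.eq_bot_iff]
    intro y hy
    refine hinj y (ext_inner_left ℝ fun z => ?_)
    rw [← hS, inner_zero_right]
    exact (Submodule.mem_orthogonal _ _).1 hy _ (LinearPMap.mem_domain_of_mem_graph ((hB (S z) z).2 rfl))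
  refine LinearPMap.isSelfAdjoint_def.2 (LinearPMap.eq_of_eq_graph ?_)
  rw [LinearPMap.adjoint_graph_eq_graph_adjoint hdense]
  ext ⟨x, y⟩
  rw [Submodule.mem_adjoint_iff, hB]
  constructor
  · intro h
    refine ext_inner_left ℝ fun z => ?_
    have := h (S z) z ((hB _ _).2 rfl)
    rw [← hS]
    simp only at this
    linarith
  · rintro rfl a b hab
    rw [(hB a b).1 hab, hS, sub_self]

/-- A coercive self-adjoint operator has a nonnegative square root. -/
theorem exists_isNonnegSqrt (A : H →ₗ.[ℝ] H) (hdense : Dense (A.domain : Set H))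
    (hA : IsSelfAdjoint A) (ν : ℝ) (hν : 0 < ν)
    (hcoer : ∀ x : A.domain, ν * ‖(x : H)‖ ^ 2 ≤ inner ℝ (A x) (x : H)) :
    ∃ B, IsNonnegSqrt A B := by
  obtain ⟨K, hK⟩ := exists_bounded_inverse A hdense hA ν hν hcoer
  have hKc : ∀ y, ν * ‖K y‖ ^ 2 ≤ inner ℝ y (K y) := by
    intro y
    have h := (hK (K y) y).2 rfl
    rw [LinearPMap.mem_graph_iff] at h
    obtain ⟨w, hw, hy⟩ := h
    have := hcoer w
    simp only at hw hy
    rwa [hy, hw] at this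
  have hKs : ∀ x y, inner ℝ (K x) y = inner ℝ x (K y) := by
    intro x y
    have e : A.graph = A.graph.adjoint := by
      rw [← LinearPMap.adjoint_graph_eq_graph_adjoint hdense]
      exact congrArg LinearPMap.graph (LinearPMap.isSelfAdjoint_def.1 hA).symm
    have hy := (hK (K y) y).2 rfl
    rw [e, Submodule.mem_adjoint_iff] at hy
    have := hy (K x) x ((hK (K x) x).2 rfl)
    simp only at this
    linarith
  -- Coercivity in the form ν|Kx|² ≤ ⟨x, Kx⟩ gives ‖1 - νK‖ ≤ 1. The root 1 - Y of νK, rescaled by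
  -- ν^{-1/2}, is a root S of K = A^{-1}, nonnegative because ‖Y‖ ≤ 1. The inverse of S is the root
  -- of A.
  let X : H →L[ℝ] H := 1 - ν • K
  have hX : ‖X‖ ≤ 1 := by
    refine ContinuousLinearMap.opNorm_le_bound _ zero_le_one fun x => ?_
    rw [one_mul]
    refine le_of_sq_le_sq ?_ (norm_nonneg x)
    change ‖x - ν • K x‖ ^ 2 ≤ _
    rw [norm_sub_sq_real, norm_smul, inner_smul_right, mul_pow, Real.norm_eq_abs, sq_abs]
    have := hKc x
    have h2 : 0 ≤ inner ℝ x (K x) := by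
      refine le_trans ?_ this; positivity
    nlinarith
  let s : Set (H →L[ℝ] H) := {Z | ∀ x y : H, inner ℝ (Z x) y = inner ℝ x (Z y)}
  have hs : IsClosed s := by
    simp only [s, ofPred_forall]
    refine isClosed_iInter fun x => isClosed_iInter fun y => isClosed_eq ?_ ?_ <;> fun_prop
  have hstep : ∀ Z ∈ s, (1 / 2 : ℝ) • (X + Z * Z) ∈ s := by
    intro Z hZ x y
    have hZ' : ∀ x y : H, inner ℝ (Z x) y = inner ℝ x (Z y) := hZ
    simp only [X, smul_apply, add_apply,
      sub_apply, one_apply_eq_self, mul_apply_eq_comp,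
      inner_smul_left, inner_smul_right, inner_add_left, inner_add_right, inner_sub_left,
      inner_sub_right, hKs, hZ']
    simp
  obtain ⟨Y, hYs, hY1, hY⟩ := exists_sqrt_one_sub X hX s hs (by intro x y; simp) hstep
  have hYs' : ∀ x y : H, inner ℝ (Y x) y = inner ℝ x (Y y) := hYs
  let r : ℝ := (√ν)⁻¹
  have hr : 0 < r := by positivity
  have hr2 : r * r * ν = 1 := by
    simp only [r]
    rw [← mul_inv, Real.mul_self_sqrt hν.le]; field_simp
  let S : H →L[ℝ] H := r • (1 - Y)
  have hSK : ∀ x, S (S x) = K x := by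
    intro x
    have h1 : (1 - Y) ((1 - Y) x) = ν • K x := by
      have := congrArg (fun T : H →L[ℝ] H => T x) hY
      simpa [X] using this
    change r • (1 - Y) (r • (1 - Y) x) = K x
    rw [map_smul, h1, smul_smul, smul_smul, hr2, one_smul]
  have hSs : ∀ x y, inner ℝ (S x) y = inner ℝ x (S y) := by
    intro x y
    simp [S, inner_smul_left, inner_smul_right, inner_sub_left, inner_sub_right, hYs']
  have hS0 : ∀ x, 0 ≤ inner ℝ (S x) x := by
    intro x
    have h1 : inner ℝ (Y x) x ≤ ‖x‖ * ‖x‖ := (real_inner_le_norm _ _).trans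
      (mul_le_mul_of_nonneg_right ((Y.le_opNorm x).trans (mul_le_of_le_one_left (norm_nonneg x) hY1))
        (norm_nonneg x))
    have h2 : inner ℝ (S x) x = r * (‖x‖ * ‖x‖ - inner ℝ (Y x) x) := by
      simp [S, inner_smul_left, inner_sub_left, ← sq]
    rw [h2]
    exact mul_nonneg hr.le (sub_nonneg.2 h1)
  have hinj : ∀ y, S y = 0 → y = 0 := by
    intro y h
    have hk : K y = 0 := by rw [← hSK, h, map_zero]
    exact A.graph_fst_eq_zero_snd ((hK (K y) y).2 rfl) hk
  let T : H →ₗ.[ℝ] H := ⟨⊤, (S : H →ₗ[ℝ] H).comp (⊤ : Submodule ℝ H).subtype⟩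
  have hT : LinearMap.ker T.toFun = ⊥ := by
    rw [Submodule.eq_bot_iff]
    rintro ⟨x, hx⟩ h
    exact Subtype.ext (hinj x h)
  have hB : ∀ x y : H, (x, y) ∈ T.inverse.graph ↔ x = S y := by
    intro x y
    rw [LinearPMap.inverse_graph hT]
    simp only [Submodule.mem_map, Prod.exists, LinearPMap.mem_graph_iff]
    constructor
    · rintro ⟨a, b, ⟨w, hw, hb⟩, h⟩
      have h' : b = x ∧ a = y := by simpa using h
      rw [← h'.1, ← h'.2, ← hw, ← hb]
      rfl
    · rintro rfl
      exact ⟨y, S y, ⟨⟨y, trivial⟩, rfl, rfl⟩, rfl⟩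
  refine ⟨T.inverse, isSelfAdjoint_of_graph_iff _ S hSs hB, fun x => ?_, fun x y => ?_⟩
  · have h := (hB _ _).1 (T.inverse.mem_graph x)
    conv_rhs => rw [h, ← hSs]
    exact hS0 _
  · rw [hK, ← hSK]
    constructor
    · rintro rfl
      exact ⟨S y, (hB _ _).2 rfl, (hB _ _).2 rfl⟩
    · rintro ⟨z, h1, h2⟩
      rw [(hB _ _).1 h1, (hB _ _).1 h2]

/-- The inverse of `A^{1/2}` as a bounded operator `S`. -/
theorem exists_inverse_sqrtOp (A : H →ₗ.[ℝ] H) (hdense : Dense (A.domain : Set H))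
    (hA : IsSelfAdjoint A) (ν : ℝ) (hν : 0 < ν)
    (hcoer : ∀ x : A.domain, ν * ‖(x : H)‖ ^ 2 ≤ inner ℝ (A x) (x : H)) :
    ∃ S : H →L[ℝ] H, (∀ x y, inner ℝ (S x) y = inner ℝ x (S y)) ∧ (∀ x, 0 ≤ inner ℝ (S x) x) ∧
      (∀ x, ν * ‖S x‖ ^ 2 ≤ ‖x‖ ^ 2) ∧ (∀ x y, (x, y) ∈ (sqrtOp A).graph ↔ x = S y) ∧
      (∀ x y, (x, y) ∈ A.graph ↔ x = S (S y)) := by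
  obtain ⟨K, hK⟩ := exists_bounded_inverse A hdense hA ν hν hcoer
  have hex := exists_isNonnegSqrt A hdense hA ν hν hcoer
  have hBsq : IsNonnegSqrt A (sqrtOp A) := by
    unfold sqrtOp
    rw [dif_pos hex]
    exact hex.choose_spec
  -- Only the properties in `IsNonnegSqrt` are used from here on, so it does not matter which root
  -- was chosen. As B ∘ B = A is a bijection from its domain onto H, so is B; its inverse is `σ`.
  set B := sqrtOp A
  have hex2 : ∀ y, ∃ x, (x, y) ∈ B.graph := fun y => by
    obtain ⟨z, -, hz⟩ := (hBsq.comp_self _ _).1 ((hK (K y) y).2 rfl)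
    exact ⟨z, hz⟩
  have huniq : ∀ x, (x, (0 : H)) ∈ B.graph → x = 0 := by
    intro x hx
    have := (hK x 0).1 ((hBsq.comp_self x 0).2 ⟨0, hx, B.graph.zero_mem⟩)
    simpa using this
  choose σ hσ using hex2
  have hσ' : ∀ x y, (x, y) ∈ B.graph → x = σ y := by
    intro x y h
    have := B.graph.sub_mem h (hσ y)
    rw [Prod.mk_sub_mk, sub_self] at this
    exact sub_eq_zero.1 (huniq _ this)
  have hsym : ∀ x y, inner ℝ (σ x) y = inner ℝ x (σ y) := by
    intro x y
    have e : B.graph = B.graph.adjoint := by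
      rw [← LinearPMap.adjoint_graph_eq_graph_adjoint hBsq.selfAdjoint.dense_domain]
      exact congrArg LinearPMap.graph (LinearPMap.isSelfAdjoint_def.1 hBsq.selfAdjoint).symm
    have hy := hσ y
    rw [e, Submodule.mem_adjoint_iff] at hy
    have := hy (σ x) x (hσ x)
    simp only at this
    linarith
  have hσσ : ∀ y, σ (σ y) = K y := by
    intro y
    exact (hK _ _).1 ((hBsq.comp_self _ _).2 ⟨σ y, hσ _, hσ _⟩)
  have hbound : ∀ y, ν * ‖σ y‖ ^ 2 ≤ ‖y‖ ^ 2 := by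
    intro y
    have h := (hK (K y) y).2 rfl
    rw [LinearPMap.mem_graph_iff] at h
    obtain ⟨w, hw, hy⟩ := h
    have h1 := hcoer w
    simp only at hw hy
    rw [hy, hw] at h1
    have h2 : ‖σ y‖ ^ 2 = inner ℝ y (K y) := by
      rw [← hσσ, ← hsym, real_inner_self_eq_norm_sq]
    have h3 := real_inner_le_norm y (K y)
    have h4 : ν * ‖K y‖ ≤ ‖y‖ := by
      rcases (norm_nonneg (K y)).eq_or_lt with h | h
      · rw [← h]; simp
      · by_contra! hlt
        nlinarith
    rw [h2]
    nlinarith [norm_nonneg y]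
  let L : H →ₗ[ℝ] H :=
    { toFun := σ
      map_add' := fun x y => (hσ' _ _ (B.graph.add_mem (hσ x) (hσ y))).symm
      map_smul' := fun a x => (hσ' _ _ (B.graph.smul_mem a (hσ x))).symm }
  let S : H →L[ℝ] H := L.mkContinuous (√(1 / ν)) fun x => by
    refine le_of_sq_le_sq ?_ (by positivity)
    rw [mul_pow, Real.sq_sqrt (by positivity), one_div, inv_mul_eq_div, le_div_iff₀ hν, mul_comm]
    exact hbound x
  have hS : ∀ y, S y = σ y := fun _ => rfl
  have hBS : ∀ x y, (x, y) ∈ B.graph ↔ x = S y := by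
    intro x y
    exact ⟨fun h => hσ' _ _ h, fun h => by rw [h]; exact hσ y⟩
  refine ⟨S, hsym, fun x => ?_, hbound, hBS, fun x y => ?_⟩
  · have h := hσ x
    rw [LinearPMap.mem_graph_iff] at h
    obtain ⟨w, hw, hy⟩ := h
    have := hBsq.nonneg w
    simp only at hw hy
    rw [hw, hy, real_inner_comm] at this
    exact this
  · rw [hK, ← hσσ]
    rfl

end Operators

/-! ### Grönwall's inequality and linear equations with bounded coefficients. -/

/-- Grönwall's inequality with a variable rate `b = Θ'`. -/
theorem le_mul_exp_of_deriv_le {Z Z' Θ b : ℝ → ℝ} {a k : ℝ}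
    (hZ : ∀ t, a ≤ t → HasDerivWithinAt Z (Z' t) (Ici a) t)
    (hΘ : ∀ t, a ≤ t → HasDerivWithinAt Θ (b t) (Ici a) t)
    {t : ℝ} (ht : a ≤ t) (h : ∀ s, a ≤ s → s ≤ t → Z' s ≤ -k * b s * Z s) :
    Z t ≤ Z a * Real.exp (-k * (Θ t - Θ a)) := by
  let W : ℝ → ℝ := fun s => Z s * Real.exp (k * Θ s)
  have hW : ∀ s, a ≤ s → HasDerivWithinAt W
      (Z' s * Real.exp (k * Θ s) + Z s * (Real.exp (k * Θ s) * (k * b s))) (Ici a) s :=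
    fun s hs => (hZ s hs).mul ((hΘ s hs).const_mul k).exp
  have hanti : AntitoneOn W (Icc a t) := by
    refine antitoneOn_of_deriv_nonpos (convex_Icc a t)
      (fun s hs => (hW s hs.1).continuousWithinAt.mono Icc_subset_Ici_self) ?_ ?_
    · intro s hs
      exact ((hW s (interior_subset hs).1).mono
        (interior_subset.trans Icc_subset_Ici_self)).differentiableWithinAt
    · intro s hs
      rw [interior_Icc] at hs
      rw [((hW s hs.1.le).hasDerivAt (Ici_mem_nhds hs.1)).deriv]
      have := h s hs.1.le hs.2.le
      have he := Real.exp_pos (k * Θ s)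
      nlinarith
  have h1 : W t ≤ W a := hanti (left_mem_Icc.2 ht) (right_mem_Icc.2 ht) ht
  have h2 : -k * (Θ t - Θ a) = k * Θ a - k * Θ t := by ring
  rw [h2, Real.exp_sub, ← mul_div_assoc, le_div_iff₀ (Real.exp_pos _)]
  exact h1

section LinearODE

variable {E : Type*} [NormedAddCommGroup E] [NormedSpace ℝ E]

/-- Weighted Picard map for `x' = L x` on the half line. -/
def picardMap (k : ℝ) (L : ℝ → E →L[ℝ] E) (x₀ : E) (y : ℝ → E) (t : ℝ) : E :=
  Real.exp (-k * max t 0) • (x₀ + ∫ s in (0 : ℝ)..max t 0, Real.exp (k * s) • L s (y s))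

/-- The gain 1/k is what turns the weighted Picard map into a contraction for large k. -/
theorem norm_integral_exp_smul_le {k : ℝ} (hk : 0 < k) {w : ℝ → E} {C : ℝ} (hw : ∀ s, ‖w s‖ ≤ C)
    {t : ℝ} (ht : 0 ≤ t) :
    ‖∫ s in (0 : ℝ)..t, Real.exp (k * s) • w s‖ ≤ C * Real.exp (k * t) / k := by
  have hC : 0 ≤ C := (norm_nonneg _).trans (hw 0)
  have hd : ∀ s ∈ uIcc 0 t, HasDerivAt (fun s => C * Real.exp (k * s) / k)
      (C * Real.exp (k * s)) s := by
    intro s _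
    have := ((((hasDerivAt_id s).const_mul k).exp).const_mul C).div_const k
    refine this.congr_deriv ?_
    simp only [id, mul_one]
    field_simp
  have hint : IntervalIntegrable (fun s => C * Real.exp (k * s)) MeasureTheory.volume 0 t :=
    Continuous.intervalIntegrable (by fun_prop) _ _
  have h1 := intervalIntegral.integral_eq_sub_of_hasDerivAt hd hint
  refine (intervalIntegral.norm_integral_le_of_norm_le ht (g := fun s => C * Real.exp (k * s))
    (Eventually.of_forall fun s _ => ?_) hint).trans ?_
  · rw [norm_smul, Real.norm_eq_abs, abs_of_pos (Real.exp_pos _), mul_comm]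
    exact mul_le_mul_of_nonneg_right (hw s) (Real.exp_pos _).le
  · rw [h1]
    have : 0 ≤ C * Real.exp (k * 0) / k := by positivity
    linarith

theorem continuous_picardMap (k : ℝ) {L : ℝ → E →L[ℝ] E} (hL : Continuous L) (x₀ : E) {y : ℝ → E}
    (hy : Continuous y) : Continuous (picardMap k L x₀ y) := by
  have hc : Continuous fun s => Real.exp (k * s) • L s (y s) := by fun_prop
  have h1 : Continuous fun t => ∫ s in (0 : ℝ)..t, Real.exp (k * s) • L s (y s) :=
    intervalIntegral.continuous_primitive (fun a b => hc.intervalIntegrable a b) 0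
  have h2 : Continuous fun t : ℝ => max t 0 := by fun_prop
  have h3 := h1.comp h2
  simp only [Function.comp_def] at h3
  unfold picardMap
  fun_prop

/-- A linear differential equation with bounded continuous coefficients has a solution on the half
line. -/
theorem exists_linear_ode [CompleteSpace E] (L : ℝ → E →L[ℝ] E) (hL : ContinuousOn L (Ici 0)) (M : ℝ)
    (hM : ∀ t, 0 ≤ t → ‖L t‖ ≤ M) (x₀ : E) :
    ∃ x : ℝ → E, x 0 = x₀ ∧ ∀ t, 0 ≤ t → HasDerivWithinAt x (L t (x t)) (Ici 0) t := by
  -- Freezing the coefficient at negative times lets the contraction act on bounded continuous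
  -- functions on ℝ. The unknown is y = exp(-kt) x, which stays bounded, and k ≥ 2M gives the
  -- contraction constant M/k ≤ 1/2.
  let L' : ℝ → E →L[ℝ] E := fun t => L (max t 0)
  have hL' : Continuous L' := hL.comp_continuous (by fun_prop) fun t => mem_Ici.2 (le_max_right _ _)
  have hM' : ∀ t, ‖L' t‖ ≤ M := fun t => hM _ (le_max_right _ _)
  have hM0 : 0 ≤ M := (norm_nonneg _).trans (hM' 0)
  obtain ⟨k, hk0, hk⟩ : ∃ k : ℝ, 0 < k ∧ 2 * M ≤ k := ⟨2 * M + 1, by positivity, by linarith⟩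
  have hbd : ∀ (y : BoundedContinuousFunction ℝ E) (t : ℝ),
      ‖picardMap k L' x₀ y t‖ ≤ ‖x₀‖ + M * ‖y‖ / k := by
    intro y t
    have hτ : 0 ≤ max t 0 := le_max_right _ _
    have h1 := norm_integral_exp_smul_le hk0 (w := fun s => L' s (y s)) (C := M * ‖y‖)
      (fun s => (L' s).le_of_opNorm_le_of_le (hM' s) (y.norm_coe_le_norm s)) hτ
    rw [picardMap, norm_smul, Real.norm_eq_abs, abs_of_pos (Real.exp_pos _)]
    have h2 := (norm_add_le x₀ _).trans (add_le_add_right h1 ‖x₀‖)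
    have h3 : Real.exp (-k * max t 0) ≤ 1 := Real.exp_le_one_iff.2 (by nlinarith)
    have h4 : Real.exp (-k * max t 0) * Real.exp (k * max t 0) = 1 := by
      rw [← Real.exp_add]; simp
    calc _ ≤ Real.exp (-k * max t 0) * (‖x₀‖ + M * ‖y‖ * Real.exp (k * max t 0) / k) :=
          mul_le_mul_of_nonneg_left h2 (Real.exp_pos _).le
      _ = Real.exp (-k * max t 0) * ‖x₀‖ +
          Real.exp (-k * max t 0) * Real.exp (k * max t 0) * (M * ‖y‖ / k) := by ring
      _ ≤ _ := by
        rw [h4, one_mul]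
        exact add_le_add_left (mul_le_of_le_one_left (norm_nonneg _) h3) _
  let Φ : BoundedContinuousFunction ℝ E → BoundedContinuousFunction ℝ E := fun y =>
    BoundedContinuousFunction.ofNormedAddCommGroup (picardMap k L' x₀ y)
      (continuous_picardMap k hL' x₀ y.continuous) _ (hbd y)
  have hΦ : ContractingWith (1 / 2) Φ := by
    refine ⟨by norm_num, LipschitzWith.of_dist_le_mul fun y z => ?_⟩
    have hC : 0 ≤ (((1 / 2 : NNReal) : ℝ)) * dist y z := by positivity
    rw [BoundedContinuousFunction.dist_le hC]
    intro t
    have hτ : 0 ≤ max t 0 := le_max_right _ _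
    have hcy : Continuous fun s => Real.exp (k * s) • L' s (y s) := by fun_prop
    have hcz : Continuous fun s => Real.exp (k * s) • L' s (z s) := by fun_prop
    have e : picardMap k L' x₀ y t - picardMap k L' x₀ z t = Real.exp (-k * max t 0) •
        ∫ s in (0 : ℝ)..max t 0, Real.exp (k * s) • L' s ((y - z) s) := by
      simp only [picardMap, BoundedContinuousFunction.coe_sub, Pi.sub_apply, map_sub, smul_sub]
      rw [intervalIntegral.integral_sub (hcy.intervalIntegrable _ _) (hcz.intervalIntegrable _ _),
        ← smul_sub, add_sub_add_left_eq_sub]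
    have h1 := norm_integral_exp_smul_le hk0 (w := fun s => L' s ((y - z) s)) (C := M * ‖y - z‖)
      (fun s => (L' s).le_of_opNorm_le_of_le (hM' s) ((y - z).norm_coe_le_norm s)) hτ
    change dist (picardMap k L' x₀ y t) (picardMap k L' x₀ z t) ≤ _
    rw [dist_eq_norm, e, norm_smul, Real.norm_eq_abs, abs_of_pos (Real.exp_pos _), dist_eq_norm]
    have h4 : Real.exp (-k * max t 0) * Real.exp (k * max t 0) = 1 := by
      rw [← Real.exp_add]; simp
    calc _ ≤ Real.exp (-k * max t 0) * (M * ‖y - z‖ * Real.exp (k * max t 0) / k) :=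
          mul_le_mul_of_nonneg_left h1 (Real.exp_pos _).le
      _ = Real.exp (-k * max t 0) * Real.exp (k * max t 0) * (M / k * ‖y - z‖) := by ring
      _ ≤ _ := by
        rw [h4, one_mul]
        refine mul_le_mul_of_nonneg_right ?_ (norm_nonneg _)
        rw [div_le_iff₀ hk0]
        norm_num
        linarith
  obtain ⟨y, hy⟩ : ∃ y, Φ y = y := ⟨_, hΦ.fixedPoint_isFixedPt⟩
  have hy' : ∀ t, picardMap k L' x₀ y t = y t := fun t => congrArg (fun z => z t) hy
  have hcy : Continuous fun s => L' s (Real.exp (k * s) • y s) := by fun_prop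
  have hx : ∀ t, 0 ≤ t →
      Real.exp (k * t) • y t = x₀ + ∫ s in (0 : ℝ)..t, L' s (Real.exp (k * s) • y s) := by
    intro t ht
    rw [← hy', picardMap, max_eq_left ht, smul_smul, ← Real.exp_add]
    simp
  refine ⟨fun t => Real.exp (k * t) • y t, ?_, fun t ht => ?_⟩
  · have := hx 0 le_rfl
    simpa using this
  · have h1 : HasDerivAt (fun t => x₀ + ∫ s in (0 : ℝ)..t, L' s (Real.exp (k * s) • y s))
        (L' t (Real.exp (k * t) • y t)) t :=
      (intervalIntegral.integral_hasDerivAt_right (hcy.intervalIntegrable _ _)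
        (hcy.stronglyMeasurableAtFilter _ _) hcy.continuousAt).const_add _
    have h2 : L' t = L t := by simp only [L', max_eq_left ht]
    rw [h2] at h1
    exact h1.hasDerivWithinAt.congr (fun s hs => hx s hs) (hx t ht)

end LinearODE

/-! ### The first order system with a bounded operator. -/

/-- Coefficients of the equation on the half line: a decreasing damping `b` with derivative `b'` and
a propagation speed `c` with derivative `c'`. -/
structure IsCoeff (b b' c c' : ℝ → ℝ) (μ M₃ M₄ : ℝ) : Prop where
  b_pos : ∀ t, 0 ≤ t → 0 < b t
  b_le_one : ∀ t, 0 ≤ t → b t ≤ 1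
  hasDeriv_b : ∀ t, 0 ≤ t → HasDerivWithinAt b (b' t) (Ici 0) t
  b'_nonpos : ∀ t, 0 ≤ t → b' t ≤ 0
  neg_sq_le : ∀ t, 0 ≤ t → -(b t) ^ 2 ≤ b' t
  μ_pos : 0 < μ
  hasDeriv_c : ∀ t, 0 ≤ t → HasDerivWithinAt c (c' t) (Ici 0) t
  c_lower : ∀ t, 0 ≤ t → μ ≤ c t
  c_upper : ∀ t, 0 ≤ t → c t ≤ M₃
  abs_c'_le : ∀ t, 0 ≤ t → |c' t| ≤ M₄ * b t

/-- The first order system `f' = R g`, `ε g' = - b g - c R f`. -/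
structure IsSystemSolution (R : H →L[ℝ] H) (ε : ℝ) (b c : ℝ → ℝ) (f g : ℝ → H) : Prop where
  hasDeriv_fst : ∀ t, 0 ≤ t → HasDerivWithinAt f (R (g t)) (Ici 0) t
  hasDeriv_snd : ∀ t, 0 ≤ t →
    HasDerivWithinAt g (-ε⁻¹ • (b t • g t + c t • R (f t))) (Ici 0) t

theorem exists_isSystemSolution [CompleteSpace H] {b b' c c' : ℝ → ℝ} {μ M₃ M₄ : ℝ}
    (hco : IsCoeff b b' c c' μ M₃ M₄) (R : H →L[ℝ] H) (ε : ℝ) (x y : H) :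
    ∃ f g : ℝ → H, f 0 = x ∧ g 0 = y ∧ IsSystemSolution R ε b c f g := by
  let π₁ := ContinuousLinearMap.fst ℝ H H
  let π₂ := ContinuousLinearMap.snd ℝ H H
  let i₁ := ContinuousLinearMap.inl ℝ H H
  let i₂ := ContinuousLinearMap.inr ℝ H H
  let L₁ : H × H →L[ℝ] H × H := i₁.comp (R.comp π₂)
  let L₂ : H × H →L[ℝ] H × H := -ε⁻¹ • i₂.comp π₂
  let L₃ : H × H →L[ℝ] H × H := -ε⁻¹ • i₂.comp (R.comp π₁)
  have hbc : ContinuousOn b (Ici 0) := fun t ht => (hco.hasDeriv_b t ht).continuousWithinAt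
  have hcc : ContinuousOn c (Ici 0) := fun t ht => (hco.hasDeriv_c t ht).continuousWithinAt
  obtain ⟨X, hX0, hX⟩ := exists_linear_ode (fun t => L₁ + (b t • L₂ + c t • L₃))
    (continuousOn_const.add ((hbc.smul continuousOn_const).add (hcc.smul continuousOn_const)))
    (‖L₁‖ + (‖L₂‖ + M₃ * ‖L₃‖)) (fun t ht => by
      refine (norm_add_le _ _).trans (add_le_add_right ((norm_add_le _ _).trans
        (add_le_add ?_ ?_)) _)
      · rw [norm_smul, Real.norm_eq_abs, abs_of_pos (hco.b_pos t ht)]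
        exact mul_le_of_le_one_left (norm_nonneg _) (hco.b_le_one t ht)
      · rw [norm_smul, Real.norm_eq_abs, abs_of_pos (hco.μ_pos.trans_le (hco.c_lower t ht))]
        exact mul_le_mul_of_nonneg_right (hco.c_upper t ht) (norm_nonneg _)) (x, y)
  refine ⟨fun t => (X t).1, fun t => (X t).2, congrArg Prod.fst hX0, congrArg Prod.snd hX0, ⟨fun t ht => ?_,
    fun t ht => ?_⟩⟩
  · have := π₁.hasFDerivAt.comp_hasDerivWithinAt t (hX t ht)
    refine this.congr_deriv ?_
    simp [π₁, L₁, L₂, L₃, i₁, i₂, π₂]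
  · have := π₂.hasFDerivAt.comp_hasDerivWithinAt t (hX t ht)
    refine this.congr_deriv ?_
    simp [π₁, L₁, L₂, L₃, i₁, i₂, π₂, smul_comm _ ε⁻¹]

namespace IsSystemSolution

variable {R : H →L[ℝ] H} {ε : ℝ} {b c : ℝ → ℝ} {f g f₂ g₂ : ℝ → H}

theorem map (h : IsSystemSolution R ε b c f g) {P : H →L[ℝ] H} (hP : ∀ x, P (R x) = R (P x)) :
    IsSystemSolution R ε b c (fun t => P (f t)) (fun t => P (g t)) := by
  refine ⟨fun t ht => ?_, fun t ht => ?_⟩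
  · refine (P.hasFDerivAt.comp_hasDerivWithinAt t (h.hasDeriv_fst t ht)).congr_deriv ?_
    simp [hP]
  · refine (P.hasFDerivAt.comp_hasDerivWithinAt t (h.hasDeriv_snd t ht)).congr_deriv ?_
    simp [hP]

end IsSystemSolution

/-- Energy estimate for the system with residuals, on bounded time intervals, uniform in the
symmetric operator `R`. -/
theorem exists_norm_sq_add_le {b b' c c' : ℝ → ℝ} {μ M₃ M₄ : ℝ}
    (hco : IsCoeff b b' c c' μ M₃ M₄) {ε : ℝ} (hε : 0 < ε) (T : ℝ) :
    ∃ K : ℝ, 0 ≤ K ∧ ∀ (R : H →L[ℝ] H), (∀ x y, inner ℝ (R x) y = inner ℝ x (R y)) →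
      ∀ (f g r₁ r₂ : ℝ → H) (η : ℝ),
      (∀ t, 0 ≤ t → HasDerivWithinAt f (R (g t) + r₁ t) (Ici 0) t) →
      (∀ t, 0 ≤ t →
        HasDerivWithinAt g (-ε⁻¹ • (b t • g t + c t • (R (f t) + r₂ t))) (Ici 0) t) →
      (∀ t ∈ Icc 0 T, ‖r₁ t‖ ≤ η) → (∀ t ∈ Icc 0 T, ‖r₂ t‖ ≤ η) →
      ∀ t ∈ Icc 0 T, ‖f t‖ ^ 2 + ‖g t‖ ^ 2 ≤ K * (‖f 0‖ ^ 2 + ‖g 0‖ ^ 2 + η ^ 2) := by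
  have hμ := hco.μ_pos
  have hM₃ : 0 < M₃ := hμ.trans_le ((hco.c_lower 0 le_rfl).trans (hco.c_upper 0 le_rfl))
  have hM₄ : 0 ≤ M₄ := by
    have h1 := (abs_nonneg _).trans (hco.abs_c'_le 0 le_rfl)
    exact nonneg_of_mul_nonneg_left h1 (hco.b_pos 0 le_rfl)
  let k : ℝ := 1 / ε + (1 + M₄) / μ + 2 * M₃ ^ 2
  let m : ℝ := min ε μ
  let Q : ℝ := ε + M₃ + 1
  have hm : 0 < m := lt_min hε hμ
  have hQ : 0 < Q := by positivity
  have hk : 0 ≤ k := by positivity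
  refine ⟨Q * Real.exp (k * T) / m, by positivity, ?_⟩
  intro R hR f g r₁ r₂ η hf hg h1 h2 t ht
  have hη : 0 ≤ η := (norm_nonneg _).trans (h1 t ht)
  -- The weights ε and c make the terms ⟨g, R f⟩ and ⟨f, R g⟩ cancel by symmetry, so ‖R‖ never
  -- enters. The constant η² is part of the energy so that the residuals are absorbed in a
  -- homogeneous Grönwall inequality.
  have hZ : ∀ t, 0 ≤ t → HasDerivWithinAt
      (fun t => ε * ‖g t‖ ^ 2 + c t * ‖f t‖ ^ 2 + η ^ 2)
      (ε * (2 * inner ℝ (g t) (-ε⁻¹ • (b t • g t + c t • (R (f t) + r₂ t)))) +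
        (c' t * ‖f t‖ ^ 2 + c t * (2 * inner ℝ (f t) (R (g t) + r₁ t)))) (Ici 0) t :=
    fun t ht => (((hg t ht).norm_sq.const_mul ε).add
      ((hco.hasDeriv_c t ht).mul (hf t ht).norm_sq)).add_const _
  have hid : ∀ t : ℝ, 0 ≤ t → HasDerivWithinAt (fun t : ℝ => t) ((fun _ => (1 : ℝ)) t) (Ici 0) t :=
    fun t _ => hasDerivWithinAt_id t _
  have key := le_mul_exp_of_deriv_le (k := -k) hZ hid ht.1 (fun s hs hst => by
    have hs' : s ∈ Icc 0 T := ⟨hs, hst.trans ht.2⟩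
    have e1 : ε * (2 * inner ℝ (g s) (-ε⁻¹ • (b s • g s + c s • (R (f s) + r₂ s)))) =
        -2 * b s * ‖g s‖ ^ 2 - 2 * c s * inner ℝ (g s) (R (f s)) - 2 * c s * inner ℝ (g s) (r₂ s) := by
      simp only [inner_smul_right, inner_add_right, real_inner_self_eq_norm_sq]
      field_simp
      ring
    have e2 : inner ℝ (f s) (R (g s)) = inner ℝ (g s) (R (f s)) := by
      rw [← hR, real_inner_comm]
    rw [e1, inner_add_right, e2]
    have n1 : |inner ℝ (g s) (r₂ s)| ≤ ‖g s‖ * η := (abs_real_inner_le_norm _ _).trans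
      (mul_le_mul_of_nonneg_left (h2 s hs') (norm_nonneg _))
    have n2 : inner ℝ (f s) (r₁ s) ≤ ‖f s‖ * η := (real_inner_le_norm _ _).trans
      (mul_le_mul_of_nonneg_left (h1 s hs') (norm_nonneg _))
    have n1' := (abs_le.1 n1).1
    have hc1 := hco.c_lower s hs
    have hc2 := hco.c_upper s hs
    have hb := hco.b_pos s hs
    have hb1 := hco.b_le_one s hs
    have hcp : c' s ≤ M₄ := (le_abs_self _).trans ((hco.abs_c'_le s hs).trans
      (mul_le_of_le_one_right hM₄ hb1))
    have hcpos : 0 < c s := hμ.trans_le hc1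
    have a1 : -(2 * c s * inner ℝ (g s) (r₂ s)) ≤ M₃ ^ 2 * η ^ 2 + ‖g s‖ ^ 2 := by
      have : -(2 * c s * inner ℝ (g s) (r₂ s)) ≤ 2 * (c s * η) * ‖g s‖ := by nlinarith
      have h3 : (c s * η) ^ 2 ≤ M₃ ^ 2 * η ^ 2 := by
        rw [mul_pow]
        exact mul_le_mul_of_nonneg_right (pow_le_pow_left₀ hcpos.le hc2 2) (sq_nonneg _)
      nlinarith [sq_nonneg (c s * η - ‖g s‖)]
    have a2 : 2 * c s * inner ℝ (f s) (r₁ s) ≤ M₃ ^ 2 * η ^ 2 + ‖f s‖ ^ 2 := by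
      have : 2 * c s * inner ℝ (f s) (r₁ s) ≤ 2 * (c s * η) * ‖f s‖ := by nlinarith
      have h3 : (c s * η) ^ 2 ≤ M₃ ^ 2 * η ^ 2 := by
        rw [mul_pow]
        exact mul_le_mul_of_nonneg_right (pow_le_pow_left₀ hcpos.le hc2 2) (sq_nonneg _)
      nlinarith [sq_nonneg (c s * η - ‖f s‖)]
    have a3 : c' s * ‖f s‖ ^ 2 ≤ M₄ * ‖f s‖ ^ 2 :=
      mul_le_mul_of_nonneg_right hcp (sq_nonneg _)
    have a4 : 0 ≤ b s * ‖g s‖ ^ 2 := by positivity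
    have k1 : ‖g s‖ ^ 2 ≤ 1 / ε * (ε * ‖g s‖ ^ 2 + c s * ‖f s‖ ^ 2 + η ^ 2) := by
      have : 0 ≤ 1 / ε * (c s * ‖f s‖ ^ 2 + η ^ 2) := by positivity
      have h : 1 / ε * (ε * ‖g s‖ ^ 2) = ‖g s‖ ^ 2 := by field_simp
      nlinarith
    have k2 : (1 + M₄) * ‖f s‖ ^ 2 ≤ (1 + M₄) / μ * (ε * ‖g s‖ ^ 2 + c s * ‖f s‖ ^ 2 + η ^ 2) := by
      rw [div_mul_eq_mul_div, le_div_iff₀ hμ, mul_assoc]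
      refine mul_le_mul_of_nonneg_left ?_ (by positivity)
      have : 0 ≤ ε * ‖g s‖ ^ 2 + η ^ 2 := by positivity
      nlinarith [mul_le_mul_of_nonneg_right hc1 (sq_nonneg ‖f s‖)]
    have k3 : 2 * M₃ ^ 2 * η ^ 2 ≤ 2 * M₃ ^ 2 * (ε * ‖g s‖ ^ 2 + c s * ‖f s‖ ^ 2 + η ^ 2) := by
      refine mul_le_mul_of_nonneg_left ?_ (by positivity)
      have : 0 ≤ ε * ‖g s‖ ^ 2 + c s * ‖f s‖ ^ 2 := by positivity
      linarith
    have hk' : - -k * 1 * (ε * ‖g s‖ ^ 2 + c s * ‖f s‖ ^ 2 + η ^ 2) =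
        1 / ε * (ε * ‖g s‖ ^ 2 + c s * ‖f s‖ ^ 2 + η ^ 2) +
        (1 + M₄) / μ * (ε * ‖g s‖ ^ 2 + c s * ‖f s‖ ^ 2 + η ^ 2) +
        2 * M₃ ^ 2 * (ε * ‖g s‖ ^ 2 + c s * ‖f s‖ ^ 2 + η ^ 2) := by
      simp only [k]; ring
    rw [hk']
    linarith)
  have hexp : Real.exp (- -k * (t - 0)) ≤ Real.exp (k * T) := by
    apply Real.exp_le_exp.2
    rw [neg_neg, sub_zero]
    exact mul_le_mul_of_nonneg_left ht.2 hk
  have hc1 := hco.c_lower t ht.1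
  have hcpos : 0 < c 0 := hμ.trans_le (hco.c_lower 0 le_rfl)
  rw [div_mul_eq_mul_div, le_div_iff₀ hm]
  have l1 : (‖f t‖ ^ 2 + ‖g t‖ ^ 2) * m ≤ ε * ‖g t‖ ^ 2 + c t * ‖f t‖ ^ 2 + η ^ 2 := by
    have m1 : m ≤ ε := min_le_left _ _
    have m2 : m ≤ c t := (min_le_right _ _).trans hc1
    nlinarith [mul_le_mul_of_nonneg_right m1 (sq_nonneg ‖g t‖),
      mul_le_mul_of_nonneg_right m2 (sq_nonneg ‖f t‖), sq_nonneg η]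
  have l2 : ε * ‖g 0‖ ^ 2 + c 0 * ‖f 0‖ ^ 2 + η ^ 2 ≤ Q * (‖f 0‖ ^ 2 + ‖g 0‖ ^ 2 + η ^ 2) := by
    have q1 : ε ≤ Q := by simp only [Q]; linarith
    have q2 : c 0 ≤ Q := by simp only [Q]; linarith [hco.c_upper 0 le_rfl]
    have q3 : 1 ≤ Q := by simp only [Q]; linarith
    nlinarith [mul_le_mul_of_nonneg_right q1 (sq_nonneg ‖g 0‖),
      mul_le_mul_of_nonneg_right q2 (sq_nonneg ‖f 0‖), mul_le_mul_of_nonneg_right q3 (sq_nonneg η)]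
  calc _ ≤ _ := l1
    _ ≤ _ := key
    _ ≤ (Q * (‖f 0‖ ^ 2 + ‖g 0‖ ^ 2 + η ^ 2)) * Real.exp (k * T) :=
      mul_le_mul l2 hexp (Real.exp_pos _).le (by positivity)
    _ = _ := by ring

/-! ### Resolvent approximation, mild pairs and passage to the limit. -/

/-- The resolvent of a bounded nonnegative symmetric operator. -/
theorem exists_resolvent [CompleteSpace H] (S : H →L[ℝ] H)
    (hS : ∀ x y, inner ℝ (S x) y = inner ℝ x (S y))
    (hS0 : ∀ x, 0 ≤ inner ℝ (S x) x) {δ : ℝ} (hδ : 0 < δ) :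
    ∃ R : H →L[ℝ] H, (∀ x, S (R x) + δ • R x = x) ∧ (∀ x, S (R x) = R (S x)) ∧
      (∀ x y, inner ℝ (R x) y = inner ℝ x (R y)) ∧ ∀ x, ‖S (R x)‖ ≤ ‖x‖ := by
  let P : H →L[ℝ] H := S + δ • 1
  have hP : ∀ x, P x = S x + δ • x := fun x => by simp [P]
  let β : H →L[ℝ] H →L[ℝ] ℝ := (innerSL ℝ).comp P
  have hβ : IsCoercive β := by
    refine ⟨δ, hδ, fun u => ?_⟩
    change _ ≤ inner ℝ (P u) u
    rw [hP, inner_add_left, real_inner_smul_left, real_inner_self_eq_norm_mul_norm]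
    linarith [hS0 u]
  let e := hβ.continuousLinearEquivOfBilin
  have he : ∀ x, e x = P x := by
    intro x
    refine (hβ.unique_continuousLinearEquivOfBilin (v := x) (f := P x) fun w => ?_).symm
    rfl
  have h1 : ∀ x, S (e.symm x) + δ • e.symm x = x := by
    intro x
    rw [← hP, ← he, e.apply_symm_apply]
  have hPs : ∀ x y, inner ℝ (P x) y = inner ℝ x (P y) := by
    intro x y
    simp [hP, inner_add_left, inner_add_right, inner_smul_left, inner_smul_right, hS]
  have h2 : ∀ x, e.symm (P x) = x := fun x => by rw [← he, e.symm_apply_apply]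
  have h1' : ∀ x, P (e.symm x) = x := fun x => by rw [hP, h1]
  refine ⟨(e.symm : H →L[ℝ] H), h1, fun x => ?_, fun x y => ?_, fun x => ?_⟩
  · change S (e.symm x) = e.symm (S x)
    conv_rhs => rw [← h1' x]
    rw [← h2 (S (e.symm x))]
    congr 1
    simp [hP]
  · change inner ℝ (e.symm x) y = inner ℝ x (e.symm y)
    conv_lhs => rw [← h1' y, ← hPs, h1']
  · change ‖S (e.symm x)‖ ≤ ‖x‖
    conv_rhs => rw [← h1 x]
    refine le_of_sq_le_sq ?_ (norm_nonneg _)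
    rw [norm_add_sq_real, real_inner_smul_right]
    have := hS0 (e.symm x)
    have h3 : 0 ≤ 2 * (δ * inner ℝ (S (e.symm x)) (e.symm x)) := by positivity
    nlinarith [sq_nonneg ‖δ • e.symm x‖]

theorem denseRange_of_symmetric [CompleteSpace H] (S : H →L[ℝ] H)
    (hS : ∀ x y, inner ℝ (S x) y = inner ℝ x (S y)) (hinj : ∀ x, S x = 0 → x = 0) :
    DenseRange S := by
  change Dense (S.range : Set H)
  rw [Submodule.dense_iff_topologicalClosure_eq_top, Submodule.topologicalClosure_eq_top_iff,
    Submodule.eq_bot_iff]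
  intro y hy
  refine hinj y (ext_inner_left ℝ fun z => ?_)
  rw [← hS, inner_zero_right]
  exact (Submodule.mem_orthogonal _ _).1 hy _ ⟨z, rfl⟩

/-- The second order equation in terms of `f = A u` and `g = A^{1/2} u'`, where `S` is the inverse
of `A^{1/2}`. -/
structure IsMildPair (S : H →L[ℝ] H) (ε : ℝ) (b c : ℝ → ℝ) (f g : ℝ → H) : Prop where
  cont_fst : ContinuousOn f (Ici 0)
  cont_snd : ContinuousOn g (Ici 0)
  hasDeriv_fst : ∀ t, 0 ≤ t → HasDerivWithinAt (fun t => S (f t)) (g t) (Ici 0) t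
  hasDeriv_snd : ∀ t, 0 ≤ t →
    HasDerivWithinAt (fun t => S (g t)) (-ε⁻¹ • (b t • S (g t) + c t • f t)) (Ici 0) t

/-- The functions f and g need not be differentiable, so the energy is taken one level lower, ε|S
y|² + c|S x|² for the differences x and y. Symmetry of S cancels its mixed terms. -/
theorem IsMildPair.unique {S : H →L[ℝ] H} (hS : ∀ x y, inner ℝ (S x) y = inner ℝ x (S y))
    {b b' c c' : ℝ → ℝ} {μ M₃ M₄ : ℝ} (hco : IsCoeff b b' c c' μ M₃ M₄) {ε : ℝ} (hε : 0 < ε)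
    {f g f₂ g₂ : ℝ → H} (h : IsMildPair S ε b c f g) (h₂ : IsMildPair S ε b c f₂ g₂)
    (hf0 : S (f 0) = S (f₂ 0)) (hg0 : S (g 0) = S (g₂ 0)) {t : ℝ} (ht : 0 ≤ t) :
    S (f t) = S (f₂ t) := by
  let x : ℝ → H := fun t => f t - f₂ t
  let y : ℝ → H := fun t => g t - g₂ t
  have hx : ∀ t, 0 ≤ t → HasDerivWithinAt (fun t => S (x t)) (y t) (Ici 0) t := by
    intro t ht
    refine ((h.hasDeriv_fst t ht).sub (h₂.hasDeriv_fst t ht)).congr_of_mem ?_ ht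
    intro s _; simp [x]
  have hy : ∀ t, 0 ≤ t → HasDerivWithinAt (fun t => S (y t))
      (-ε⁻¹ • (b t • S (y t) + c t • x t)) (Ici 0) t := by
    intro t ht
    refine (((h.hasDeriv_snd t ht).sub (h₂.hasDeriv_snd t ht)).congr_of_mem ?_ ht).congr_deriv ?_
    · intro s _; simp [y]
    · simp only [x, y, map_sub, ← smul_sub]
      congr 1
      simp only [smul_sub]
      abel
  have hZ : ∀ t, 0 ≤ t → HasDerivWithinAt (fun t => ε * ‖S (y t)‖ ^ 2 + c t * ‖S (x t)‖ ^ 2)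
      (ε * (2 * inner ℝ (S (y t)) (-ε⁻¹ • (b t • S (y t) + c t • x t))) +
        (c' t * ‖S (x t)‖ ^ 2 + c t * (2 * inner ℝ (S (x t)) (y t)))) (Ici 0) t :=
    fun t ht => ((hy t ht).norm_sq.const_mul ε).add
      ((hco.hasDeriv_c t ht).mul (hx t ht).norm_sq)
  have hμ := hco.μ_pos
  have hM₄ : 0 ≤ M₄ := by
    have h1 := (abs_nonneg _).trans (hco.abs_c'_le 0 le_rfl)
    exact nonneg_of_mul_nonneg_left h1 (hco.b_pos 0 le_rfl)
  have hid : ∀ t : ℝ, 0 ≤ t → HasDerivWithinAt (fun t : ℝ => t) ((fun _ => (1 : ℝ)) t) (Ici 0) t :=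
    fun t _ => hasDerivWithinAt_id t _
  have key := le_mul_exp_of_deriv_le (k := -(M₄ / μ)) hZ hid ht (fun s hs _ => by
    have e1 : ε * (2 * inner ℝ (S (y s)) (-ε⁻¹ • (b s • S (y s) + c s • x s))) =
        -2 * b s * ‖S (y s)‖ ^ 2 - 2 * c s * inner ℝ (S (y s)) (x s) := by
      simp only [inner_smul_right, inner_add_right, real_inner_self_eq_norm_sq]
      field_simp
      ring
    have e2 : inner ℝ (S (x s)) (y s) = inner ℝ (S (y s)) (x s) := by
      rw [hS, real_inner_comm]
    rw [e1, e2]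
    have hb := hco.b_pos s hs
    have hcp : c' s ≤ M₄ := (le_abs_self _).trans ((hco.abs_c'_le s hs).trans
      (mul_le_of_le_one_right hM₄ (hco.b_le_one s hs)))
    have a3 : c' s * ‖S (x s)‖ ^ 2 ≤ M₄ * ‖S (x s)‖ ^ 2 :=
      mul_le_mul_of_nonneg_right hcp (sq_nonneg _)
    have a4 : 0 ≤ b s * ‖S (y s)‖ ^ 2 := by positivity
    have a5 : M₄ * ‖S (x s)‖ ^ 2 ≤ M₄ / μ * (ε * ‖S (y s)‖ ^ 2 + c s * ‖S (x s)‖ ^ 2) := by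
      rw [div_mul_eq_mul_div, le_div_iff₀ hμ, mul_assoc]
      refine mul_le_mul_of_nonneg_left ?_ hM₄
      have : 0 ≤ ε * ‖S (y s)‖ ^ 2 := by positivity
      nlinarith [mul_le_mul_of_nonneg_right (hco.c_lower s hs) (sq_nonneg ‖S (x s)‖)]
    linarith)
  have hx0 : S (x 0) = 0 := by simp [x, hf0]
  have hy0 : S (y 0) = 0 := by simp [y, hg0]
  rw [hx0, hy0] at key
  simp only [norm_zero, ne_eq, OfNat.ofNat_ne_zero, not_false_eq_true, zero_pow, mul_zero,
    add_zero, zero_mul] at key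
  have h1 : c t * ‖S (x t)‖ ^ 2 ≤ 0 := by
    have : 0 ≤ ε * ‖S (y t)‖ ^ 2 := by positivity
    linarith
  have h2 : ‖S (x t)‖ ^ 2 ≤ 0 := by
    by_contra! hlt
    have := mul_pos (hμ.trans_le (hco.c_lower t ht)) hlt
    linarith
  have h3 : S (x t) = 0 := by
    rw [← norm_eq_zero]
    exact pow_eq_zero_iff two_ne_zero |>.1 (le_antisymm h2 (sq_nonneg _))
  simpa [x, sub_eq_zero] using h3

/-- Derivatives on the half line pass to limits if they converge uniformly on bounded intervals. -/
theorem hasDerivWithinAt_of_tendstoUniformlyOn {E : Type*} [NormedAddCommGroup E] [NormedSpace ℝ E]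
    {u u' : ℕ → ℝ → E} {v v' : ℝ → E}
    (hu : ∀ n t, 0 ≤ t → HasDerivWithinAt (u n) (u' n t) (Ici 0) t)
    (hv : ∀ t, 0 ≤ t → Tendsto (fun n => u n t) atTop (𝓝 (v t)))
    (hu' : ∀ T, TendstoUniformlyOn u' v' atTop (Icc 0 T))
    (hcv : ContinuousOn v (Ici 0)) (hcv' : ContinuousOn v' (Ici 0)) {t : ℝ} (ht : 0 ≤ t) :
    HasDerivWithinAt v (v' t) (Ici 0) t := by
  have hpos : ∀ t ∈ Ioi (0 : ℝ), HasDerivAt v (v' t) t := by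
    intro t ht
    refine hasDerivAt_of_tendstoLocallyUniformlyOn isOpen_Ioi (f := u) (f' := u') (l := atTop)
      ?_ ?_ (fun x hx => hv x (le_of_lt hx)) ht
    · intro s hs x hx
      exact ⟨Icc 0 (x + 1), mem_nhdsWithin_of_mem_nhds (Icc_mem_nhds hx (lt_add_one x)),
        hu' (x + 1) s hs⟩
    · exact Eventually.of_forall fun n x hx => (hu n x (le_of_lt hx)).hasDerivAt (Ici_mem_nhds hx)
  rcases ht.eq_or_lt with rfl | h
  -- At the endpoint the one-sided derivative is the right limit of the derivatives at positive
  -- times.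
  · refine hasDerivWithinAt_Ici_of_tendsto_deriv (s := Ioi 0)
      (fun x hx => (hpos x hx).differentiableAt.differentiableWithinAt)
      ((hcv 0 self_mem_Ici).mono Ioi_subset_Ici_self) self_mem_nhdsWithin ?_
    have h1 : Tendsto v' (𝓝[>] 0) (𝓝 (v' 0)) :=
      (hcv' 0 self_mem_Ici).mono Ioi_subset_Ici_self
    refine h1.congr' ?_
    filter_upwards [self_mem_nhdsWithin] with x hx
    exact (hpos x hx).deriv.symm
  · exact (hpos t h).hasDerivWithinAt

theorem tendstoUniformlyOn_of_norm_sub_le {E : Type*} [NormedAddCommGroup E]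
    {u : ℕ → ℝ → E} {v : ℝ → E} {F G : ℕ → ℝ → E} {f g : ℝ → E} {s : Set ℝ} {k : ℝ} (hk : 0 ≤ k)
    {a : ℕ → ℝ} (ha : Tendsto a atTop (𝓝 0)) (hF : TendstoUniformlyOn F f atTop s)
    (hG : TendstoUniformlyOn G g atTop s)
    (h : ∀ n, ∀ t ∈ s, ‖u n t - v t‖ ≤ k * (‖F n t - f t‖ + ‖G n t - g t‖) + a n) :
    TendstoUniformlyOn u v atTop s := by
  rw [Metric.tendstoUniformlyOn_iff] at *
  intro e he
  have he' : 0 < e / (4 * (k + 1)) := by positivity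
  filter_upwards [hF _ he', hG _ he', ha.eventually (gt_mem_nhds (half_pos he))] with n h1 h2 h3 t ht
  have h1' := h1 t ht
  have h2' := h2 t ht
  rw [dist_eq_norm, norm_sub_rev] at h1' h2' ⊢
  have h4 := h n t ht
  have h5 : k * (‖F n t - f t‖ + ‖G n t - g t‖) ≤ (k + 1) * (2 * (e / (4 * (k + 1)))) := by
    refine mul_le_mul (by linarith) (by linarith) (by positivity) (by positivity)
  have h6 : (k + 1) * (2 * (e / (4 * (k + 1)))) = e / 2 := by field_simp; norm_num
  linarith

/-- A sequence of curves that is uniformly Cauchy on bounded intervals of the half line converges. -/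
theorem exists_tendstoUniformlyOn {E : Type*} [NormedAddCommGroup E] [CompleteSpace E]
    {F : ℕ → ℝ → E} (hF : ∀ n, ContinuousOn (F n) (Ici 0))
    (h : ∀ T, 0 ≤ T → ∀ e > 0, ∃ N, ∀ m ≥ N, ∀ n ≥ N, ∀ t ∈ Icc 0 T, ‖F m t - F n t‖ < e) :
    ∃ f : ℝ → E, ContinuousOn f (Ici 0) ∧ (∀ T, TendstoUniformlyOn F f atTop (Icc 0 T)) ∧
      ∀ t, 0 ≤ t → Tendsto (fun n => F n t) atTop (𝓝 (f t)) := by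
  have hlim : ∀ t : ℝ, ∃ y, 0 ≤ t → Tendsto (fun n => F n t) atTop (𝓝 y) := by
    intro t
    by_cases ht : 0 ≤ t
    · have hc : CauchySeq fun n => F n t := by
        rw [Metric.cauchySeq_iff]
        intro e he
        obtain ⟨N, hN⟩ := h t ht e he
        exact ⟨N, fun m hm n hn => by rw [dist_eq_norm]; exact hN m hm n hn t ⟨ht, le_rfl⟩⟩
      obtain ⟨y, hy⟩ := cauchySeq_tendsto_of_complete hc
      exact ⟨y, fun _ => hy⟩
    · exact ⟨0, fun h => absurd h ht⟩
  choose f hf using hlim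
  have hunif : ∀ T, TendstoUniformlyOn F f atTop (Icc 0 T) := by
    intro T
    refine UniformCauchySeqOn.tendstoUniformlyOn_of_tendsto ?_ fun t ht => hf t ht.1
    rcases lt_or_ge T 0 with hT | hT
    · rw [Icc_eq_empty (not_le.2 hT)]
      intro s _
      exact Eventually.of_forall fun _ x hx => absurd hx (notMem_empty x)
    · rw [Metric.uniformCauchySeqOn_iff]
      intro e he
      obtain ⟨N, hN⟩ := h T hT e he
      exact ⟨N, fun m hm n hn t ht => by rw [dist_eq_norm]; exact hN m hm n hn t ht⟩
  refine ⟨f, fun t ht => ?_, hunif, hf⟩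
  have h1 : ContinuousOn f (Icc 0 (t + 1)) := (hunif (t + 1)).continuousOn
    (Eventually.of_forall fun n => (hF n).mono Icc_subset_Ici_self).frequently
  refine (h1 t ⟨ht, by linarith⟩).mono_of_mem_nhdsWithin ?_
  rw [← Ici_inter_Iic]
  exact inter_mem self_mem_nhdsWithin (mem_nhdsWithin_of_mem_nhds (Iic_mem_nhds (lt_add_one t)))

/-- The bounded approximations of the equation. -/
structure IsApprox (S : H →L[ℝ] H) (δ : ℕ → ℝ) (R : ℕ → H →L[ℝ] H) : Prop where
  δ_pos : ∀ n, 0 < δ n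
  tendsto_δ : Tendsto δ atTop (𝓝 0)
  resolvent : ∀ n x, S (R n x) + δ n • R n x = x
  comm : ∀ n x, S (R n x) = R n (S x)
  symm : ∀ n x y, inner ℝ (R n x) y = inner ℝ x (R n y)
  norm_le : ∀ n x, ‖S (R n x)‖ ≤ ‖x‖

theorem exists_isApprox [CompleteSpace H] (S : H →L[ℝ] H)
    (hS : ∀ x y, inner ℝ (S x) y = inner ℝ x (S y)) (hS0 : ∀ x, 0 ≤ inner ℝ (S x) x) :
    ∃ (δ : ℕ → ℝ) (R : ℕ → H →L[ℝ] H), IsApprox S δ R := by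
  choose R h1 h2 h3 h4 using fun n : ℕ =>
    exists_resolvent S hS hS0 (δ := 1 / ((n : ℝ) + 1)) (by positivity)
  exact ⟨_, R, fun n => by positivity, tendsto_one_div_add_atTop_nhds_zero_nat, h1, h2, h3, h4⟩

/-- Resolvent identity: R_m - R_n = (δ_n - δ_m) R_n R_m, where each resolvent is paired with one
factor S, and S R_n and S R_m are contractions. -/
theorem IsApprox.norm_resolvent_sub_le {S : H →L[ℝ] H} {δ : ℕ → ℝ} {R : ℕ → H →L[ℝ] H}
    (h : IsApprox S δ R) (m n : ℕ) (x : H) :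
    ‖R m (S (S x)) - R n (S (S x))‖ ≤ |δ n - δ m| * ‖x‖ := by
  have hinj : ∀ y, R n (S y + δ n • y) = y := by
    intro y
    rw [map_add, map_smul, ← h.comm, h.resolvent]
  have e : R m (S (S x)) - R n (S (S x)) = (δ n - δ m) • S (R n (S (R m x))) := by
    have h1 : R m (S (S x)) = R n (S (R m (S (S x))) + δ n • R m (S (S x))) := (hinj _).symm
    have h2 : S (R m (S (S x))) = S (S x) - δ m • R m (S (S x)) :=
      eq_sub_of_add_eq (h.resolvent m _)
    rw [h1, h2, ← map_sub]
    have h3 : S (S x) - δ m • R m (S (S x)) + δ n • R m (S (S x)) - S (S x)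
        = (δ n - δ m) • R m (S (S x)) := by rw [sub_smul]; abel
    rw [h3, map_smul, h.comm n, h.comm m, h.comm m]
  rw [e, norm_smul, Real.norm_eq_abs]
  exact mul_le_mul_of_nonneg_left ((h.norm_le n _).trans (h.norm_le m x)) (abs_nonneg _)

/-- The solutions of the approximate systems converge, uniformly on bounded time intervals. -/
theorem IsApprox.uniformCauchy [CompleteSpace H] {S : H →L[ℝ] H} {δ : ℕ → ℝ} {R : ℕ → H →L[ℝ] H}
    (h : IsApprox S δ R) (hdense : DenseRange S)
    {b b' c c' : ℝ → ℝ} {μ M₃ M₄ : ℝ} (hco : IsCoeff b b' c c' μ M₃ M₄) {ε : ℝ} (hε : 0 < ε)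
    {F G : ℕ → ℝ → H} {x y : H} (hF0 : ∀ n, F n 0 = x) (hG0 : ∀ n, G n 0 = y)
    (hsol : ∀ n, IsSystemSolution (R n) ε b c (F n) (G n)) (T : ℝ) {e : ℝ} (he : 0 < e) :
    ∃ N, ∀ m ≥ N, ∀ n ≥ N, ∀ t ∈ Icc 0 T, ‖F m t - F n t‖ < e ∧ ‖G m t - G n t‖ < e := by
  obtain ⟨K, hK0, hK⟩ := exists_norm_sq_add_le (H := H) hco hε T
  -- Data in the dense range of S² are treated first. For them the solution is S²(P, Q) with (P, Q)
  -- bounded independently of n, and exchanging R_n for R_m leaves a residual of size |δ_n - δ_m| D.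
  -- General data follow by approximation within ρ.
  have hd2 : DenseRange fun z => S (S z) :=
    DenseRange.comp (f := S) (g := S) hdense hdense S.continuous
  let ρ : ℝ := e / (4 * (K + 1))
  have hρ : 0 < ρ := by positivity
  obtain ⟨φ, hφ⟩ := hd2.exists_dist_lt x hρ
  obtain ⟨ψ, hψ⟩ := hd2.exists_dist_lt y hρ
  rw [dist_eq_norm] at hφ hψ
  choose P Q hP0 hQ0 hPQ using fun n => exists_isSystemSolution hco (R n) ε φ ψ
  have hSR : ∀ n z, (S.comp S) (R n z) = R n ((S.comp S) z) := by
    intro n z; simp [h.comm]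
  have hSS := fun n => (hPQ n).map (P := S.comp S) (hSR n)
  have b1 : ∀ n, ∀ t ∈ Icc 0 T, ‖P n t‖ ^ 2 + ‖Q n t‖ ^ 2 ≤ K * (‖φ‖ ^ 2 + ‖ψ‖ ^ 2) := by
    intro n t ht
    have := hK (R n) (h.symm n) (P n) (Q n) (fun _ => 0) (fun _ => 0) 0
      (fun t ht => by simpa using (hPQ n).hasDeriv_fst t ht)
      (fun t ht => by simpa using (hPQ n).hasDeriv_snd t ht) (by simp) (by simp) t ht
    simpa [hP0, hQ0] using this
  have b2 : ∀ n, ∀ t ∈ Icc 0 T,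
      ‖F n t - S (S (P n t))‖ ^ 2 + ‖G n t - S (S (Q n t))‖ ^ 2 ≤ K * (ρ ^ 2 + ρ ^ 2) := by
    intro n t ht
    have := hK (R n) (h.symm n) (fun t => F n t - S (S (P n t))) (fun t => G n t - S (S (Q n t)))
      (fun _ => 0) (fun _ => 0) 0
      (fun t ht => by
        refine (((hsol n).hasDeriv_fst t ht).sub ((hSS n).hasDeriv_fst t ht)).congr_deriv ?_
        simp)
      (fun t ht => by
        refine (((hsol n).hasDeriv_snd t ht).sub ((hSS n).hasDeriv_snd t ht)).congr_deriv ?_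
        simp only [ContinuousLinearMap.comp_apply, map_sub, ← smul_sub, add_zero]
        congr 1
        simp only [smul_sub]
        abel) (by simp) (by simp) t ht
    refine this.trans (mul_le_mul_of_nonneg_left ?_ hK0)
    simp only [hF0, hG0, hP0, hQ0]
    have := pow_le_pow_left₀ (norm_nonneg _) hφ.le 2
    have := pow_le_pow_left₀ (norm_nonneg _) hψ.le 2
    linarith
  let D : ℝ := √(K * (‖φ‖ ^ 2 + ‖ψ‖ ^ 2))
  have hPD : ∀ n, ∀ t ∈ Icc 0 T, ‖P n t‖ ≤ D ∧ ‖Q n t‖ ≤ D := by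
    intro n t ht
    have := b1 n t ht
    exact ⟨Real.le_sqrt_of_sq_le (by nlinarith [sq_nonneg ‖Q n t‖]),
      Real.le_sqrt_of_sq_le (by nlinarith [sq_nonneg ‖P n t‖])⟩
  have b3 : ∀ m n, ∀ t ∈ Icc 0 T,
      ‖S (S (P m t)) - S (S (P n t))‖ ^ 2 + ‖S (S (Q m t)) - S (S (Q n t))‖ ^ 2 ≤
        K * (|δ n - δ m| * D) ^ 2 := by
    intro m n t ht
    have := hK (R m) (h.symm m) (fun t => S (S (P m t)) - S (S (P n t)))
      (fun t => S (S (Q m t)) - S (S (Q n t)))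
      (fun t => R m (S (S (Q n t))) - R n (S (S (Q n t))))
      (fun t => R m (S (S (P n t))) - R n (S (S (P n t)))) (|δ n - δ m| * D)
      (fun t ht => by
        refine (((hSS m).hasDeriv_fst t ht).sub ((hSS n).hasDeriv_fst t ht)).congr_deriv ?_
        simp)
      (fun t ht => by
        refine (((hSS m).hasDeriv_snd t ht).sub ((hSS n).hasDeriv_snd t ht)).congr_deriv ?_
        simp only [ContinuousLinearMap.comp_apply, map_sub, ← smul_sub]
        congr 1
        simp only [smul_sub, smul_add]
        abel)
      (fun t ht => (h.norm_resolvent_sub_le m n _).trans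
        (mul_le_mul_of_nonneg_left (hPD n t ht).2 (abs_nonneg _)))
      (fun t ht => (h.norm_resolvent_sub_le m n _).trans
        (mul_le_mul_of_nonneg_left (hPD n t ht).1 (abs_nonneg _))) t ht
    simpa [hP0, hQ0] using this
  have hD : 0 ≤ D := Real.sqrt_nonneg _
  have hcs : CauchySeq δ := h.tendsto_δ.cauchySeq
  rw [Metric.cauchySeq_iff] at hcs
  obtain ⟨N, hN⟩ := hcs (ρ / (D + 1)) (by positivity)
  -- A difference of two solutions splits into three pieces, each of norm at most √(2K) ρ ≤ (K + 1)
  -- ρ = e/4.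
  have hfin : ∀ u v w : H, ∀ r : ℝ, 0 ≤ r → r ≤ ρ → ‖u‖ ^ 2 ≤ K * (ρ ^ 2 + ρ ^ 2) →
      ‖w‖ ^ 2 ≤ K * (ρ ^ 2 + ρ ^ 2) → ‖v‖ ^ 2 ≤ K * r ^ 2 → ‖u + v - w‖ < e := by
    intro u v w r hr hrρ hu hw hv
    have hq : ∀ z : H, ‖z‖ ^ 2 ≤ K * (ρ ^ 2 + ρ ^ 2) → ‖z‖ ≤ (K + 1) * ρ := by
      intro z hz
      refine le_of_sq_le_sq (hz.trans ?_) (by positivity)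
      rw [mul_pow]
      nlinarith [sq_nonneg ρ, mul_nonneg (sq_nonneg K) (sq_nonneg ρ)]
    have hv' : ‖v‖ ^ 2 ≤ K * (ρ ^ 2 + ρ ^ 2) := hv.trans (mul_le_mul_of_nonneg_left
      (by nlinarith [sq_nonneg ρ]) hK0)
    have h1 := (norm_sub_le (u + v) w).trans (add_le_add_left (norm_add_le u v) ‖w‖)
    have h2 : (K + 1) * ρ = e / 4 := by simp only [ρ]; field_simp
    linarith [hq u hu, hq w hw, hq v hv']
  refine ⟨N, fun m hm n hn t ht => ?_⟩
  have hr : |δ n - δ m| * D ≤ ρ := by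
    have := hN n hn m hm
    rw [Real.dist_eq, lt_div_iff₀ (by positivity)] at this
    nlinarith [abs_nonneg (δ n - δ m)]
  have hr0 : 0 ≤ |δ n - δ m| * D := by positivity
  have c1 := b2 m t ht
  have c2 := b2 n t ht
  have c3 := b3 m n t ht
  constructor
  · have := hfin (F m t - S (S (P m t))) (S (S (P m t)) - S (S (P n t))) (F n t - S (S (P n t)))
      _ hr0 hr (by nlinarith [sq_nonneg ‖G m t - S (S (Q m t))‖])
      (by nlinarith [sq_nonneg ‖G n t - S (S (Q n t))‖])
      (by nlinarith [sq_nonneg ‖S (S (Q m t)) - S (S (Q n t))‖])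
    simpa using this
  · have := hfin (G m t - S (S (Q m t))) (S (S (Q m t)) - S (S (Q n t))) (G n t - S (S (Q n t)))
      _ hr0 hr (by nlinarith [sq_nonneg ‖F m t - S (S (P m t))‖])
      (by nlinarith [sq_nonneg ‖F n t - S (S (P n t))‖])
      (by nlinarith [sq_nonneg ‖S (S (P m t)) - S (S (P n t))‖])
    simpa using this

/-- Existence of mild pairs, as limits of solutions of the approximate systems. -/
theorem IsApprox.exists_isMildPair [CompleteSpace H] {S : H →L[ℝ] H} {δ : ℕ → ℝ}
    {R : ℕ → H →L[ℝ] H} (h : IsApprox S δ R) (hdense : DenseRange S)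
    {b b' c c' : ℝ → ℝ} {μ M₃ M₄ : ℝ} (hco : IsCoeff b b' c c' μ M₃ M₄) {ε : ℝ} (hε : 0 < ε)
    (x y : H) :
    ∃ (f g : ℝ → H) (F G : ℕ → ℝ → H), f 0 = x ∧ g 0 = y ∧ IsMildPair S ε b c f g ∧
      (∀ n, F n 0 = x) ∧ (∀ n, G n 0 = y) ∧ (∀ n, IsSystemSolution (R n) ε b c (F n) (G n)) ∧
      (∀ t, 0 ≤ t → Tendsto (fun n => F n t) atTop (𝓝 (f t))) ∧
      ∀ t, 0 ≤ t → Tendsto (fun n => G n t) atTop (𝓝 (g t)) := by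
  choose F G hF0 hG0 hsol using fun n => exists_isSystemSolution hco (R n) ε x y
  have hcau := fun T e he => h.uniformCauchy hdense hco hε hF0 hG0 hsol T (e := e) he
  obtain ⟨f, hfc, hfu, hft⟩ := exists_tendstoUniformlyOn
    (fun n t ht => ((hsol n).hasDeriv_fst t ht).continuousWithinAt) (fun T _ e he => by
      obtain ⟨N, hN⟩ := hcau T e he
      exact ⟨N, fun m hm n hn t ht => (hN m hm n hn t ht).1⟩)
  obtain ⟨g, hgc, hgu, hgt⟩ := exists_tendstoUniformlyOn
    (fun n t ht => ((hsol n).hasDeriv_snd t ht).continuousWithinAt) (fun T _ e he => by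
      obtain ⟨N, hN⟩ := hcau T e he
      exact ⟨N, fun m hm n hn t ht => (hN m hm n hn t ht).2⟩)
  have hlim0 : ∀ {X : ℕ → ℝ → H} {z : ℝ → H}, (∀ t, 0 ≤ t → Tendsto (fun n => X n t) atTop (𝓝 (z t))) →
      ∀ t, 0 ≤ t → Tendsto (fun n => S (X n t) + δ n • X n t) atTop (𝓝 (S (z t))) := by
    intro X z hX t ht
    have h1 := ((S.continuous.tendsto _).comp (hX t ht)).add (h.tendsto_δ.smul (hX t ht))
    simpa using h1
  have hbc : ContinuousOn b (Ici 0) := fun t ht => (hco.hasDeriv_b t ht).continuousWithinAt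
  have hcc : ContinuousOn c (Ici 0) := fun t ht => (hco.hasDeriv_c t ht).continuousWithinAt
  have hM₃ : 0 ≤ M₃ := hco.μ_pos.le.trans ((hco.c_lower 0 le_rfl).trans (hco.c_upper 0 le_rfl))
  refine ⟨f, g, F, G, ?_, ?_, ⟨hfc, hgc, fun t ht => ?_, fun t ht => ?_⟩, hF0, hG0, hsol, hft, hgt⟩
  · exact tendsto_nhds_unique (hft 0 le_rfl) (by simp [hF0])
  · exact tendsto_nhds_unique (hgt 0 le_rfl) (by simp [hG0])
  -- Applying S + δ_n to the approximate system removes R_n, whose norms need not stay bounded; the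
  -- remaining terms converge uniformly on bounded intervals.
  · refine hasDerivWithinAt_of_tendstoUniformlyOn (u := fun n t => S (F n t) + δ n • F n t)
      (u' := G) ?_ (hlim0 hft) hgu (S.continuous.comp_continuousOn hfc) hgc ht
    intro n t ht
    have h1 := (hsol n).hasDeriv_fst t ht
    refine ((S.hasFDerivAt.comp_hasDerivWithinAt t h1).add (h1.const_smul (δ n))).congr_deriv ?_
    exact h.resolvent n _
  · refine hasDerivWithinAt_of_tendstoUniformlyOn (u := fun n t => S (G n t) + δ n • G n t)
      (u' := fun n t => -ε⁻¹ • (b t • (S (G n t) + δ n • G n t) + c t • F n t))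
      (v' := fun t => -ε⁻¹ • (b t • S (g t) + c t • f t)) ?_ (hlim0 hgt) ?_ (S.continuous.comp_continuousOn hgc) ?_ ht
    · intro n t ht
      have h1 := (hsol n).hasDeriv_snd t ht
      refine ((S.hasFDerivAt.comp_hasDerivWithinAt t h1).add (h1.const_smul (δ n))).congr_deriv ?_
      have h2 := h.resolvent n (F n t)
      rw [map_smul, smul_comm (δ n) (-ε⁻¹), ← smul_add]
      congr 1
      nth_rewrite 3 [← h2]
      simp only [map_add, map_smul, smul_add, smul_comm (δ n)]
      abel
    · intro T
      obtain ⟨K, hK0, hK⟩ := exists_norm_sq_add_le (H := H) hco hε T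
      -- A bound on G_n uniform in n, so that the extra term δ_n G_n tends to 0.
      let D : ℝ := √(K * (‖x‖ ^ 2 + ‖y‖ ^ 2))
      have hGD : ∀ n, ∀ t ∈ Icc 0 T, ‖G n t‖ ≤ D := by
        intro n t ht
        have := hK (R n) (h.symm n) (F n) (G n) (fun _ => 0) (fun _ => 0) 0
          (fun t ht => by simpa using (hsol n).hasDeriv_fst t ht)
          (fun t ht => by simpa using (hsol n).hasDeriv_snd t ht) (by simp) (by simp) t ht
        simp only [hF0, hG0] at this
        exact Real.le_sqrt_of_sq_le (by nlinarith [sq_nonneg ‖F n t‖])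
      refine tendstoUniformlyOn_of_norm_sub_le (k := ε⁻¹ * (‖S‖ + M₃))
        (a := fun n => ε⁻¹ * (δ n * D)) (by positivity) ?_ (hfu T) (hgu T) ?_
      · have := (h.tendsto_δ.mul_const D).const_mul ε⁻¹
        simpa using this
      · intro n t ht
        have hb0 := hco.b_pos t ht.1
        have hb1 := hco.b_le_one t ht.1
        have hc0 := hco.μ_pos.trans_le (hco.c_lower t ht.1)
        have hc1 := hco.c_upper t ht.1
        have e1 : -ε⁻¹ • (b t • (S (G n t) + δ n • G n t) + c t • F n t) -
            -ε⁻¹ • (b t • S (g t) + c t • f t) =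
            -ε⁻¹ • (b t • (S (G n t - g t) + δ n • G n t) + c t • (F n t - f t)) := by
          rw [← smul_sub]
          congr 1
          simp only [map_sub, smul_sub, smul_add]
          abel
        rw [e1, norm_smul, norm_neg, norm_inv, Real.norm_eq_abs, abs_of_pos hε]
        have n1 : ‖S (G n t - g t) + δ n • G n t‖ ≤ ‖S‖ * ‖G n t - g t‖ + δ n * D := by
          refine (norm_add_le _ _).trans (add_le_add (S.le_opNorm _) ?_)
          rw [norm_smul, Real.norm_eq_abs, abs_of_pos (h.δ_pos n)]
          exact mul_le_mul_of_nonneg_left (hGD n t ht) (h.δ_pos n).le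
        have n2 : ‖b t • (S (G n t - g t) + δ n • G n t) + c t • (F n t - f t)‖ ≤
            (‖S‖ * ‖G n t - g t‖ + δ n * D) + M₃ * ‖F n t - f t‖ := by
          refine (norm_add_le _ _).trans (add_le_add ?_ ?_)
          · rw [norm_smul, Real.norm_eq_abs, abs_of_pos hb0]
            exact (mul_le_of_le_one_left (norm_nonneg _) hb1).trans n1
          · rw [norm_smul, Real.norm_eq_abs, abs_of_pos hc0]
            exact mul_le_mul_of_nonneg_right hc1 (norm_nonneg _)
        rw [mul_assoc, ← mul_add]
        refine mul_le_mul_of_nonneg_left (n2.trans ?_) (by positivity)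
        have p1 : 0 ≤ ‖S‖ * ‖F n t - f t‖ := by positivity
        have p2 : 0 ≤ M₃ * ‖G n t - g t‖ := by positivity
        linarith
    · exact ((hbc.smul (S.continuous.comp_continuousOn hgc)).add (hcc.smul hfc)).const_smul _

/-! ### Decay of the energy, uniformly in ε. -/

/-- The pointwise inequality behind the decay of the modified energy, where `a = |g|²`, `φ = |f|²`,
`η = |h|²` and `w = ⟨h, g⟩`. -/
theorem modified_energy_inequality {b b' c c' μ M₃ M₄ q κ β l ε a φ η w : ℝ} (hb : 0 < b)
    (hb1 : b ≤ 1) (hbq : b ^ 2 ≤ q) (hb' : b' ≤ 0) (hbb : -b ^ 2 ≤ b') (hμ : 0 < μ) (hc : μ ≤ c)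
    (hcM : c ≤ M₃) (hM₄ : 0 ≤ M₄) (hc' : |c'| ≤ M₄ * b) (hη : 0 ≤ η) (hηφ : η ≤ κ * φ) (ha : 0 ≤ a)
    (hφ : 0 ≤ φ) (hw : |2 * w| ≤ a + η) (hβ : 0 ≤ β) (hl : 0 ≤ l) (hε : 0 < ε)
    (hlβ : β + 1 ≤ l * (2 * μ - β * q * κ))
    (h1 : ε * (M₄ / μ ^ 2 + 2 * l + β / μ + l * (1 + β)) ≤ 2 / M₃)
    (h2 : ε * (l * (1 + β) * κ) ≤ 1) :
    -(2 * b / c) * a - ε * (c' / c ^ 2) * a + l * (b' * (2 * (ε * w) + b * η)) +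
        l * (b * (2 * ε * a - 2 * c * φ + b' * η)) ≤
      -β * b * (ε * (a / c) + φ + l * (b * (2 * (ε * w) + b * η))) := by
  have hcpos : 0 < c := hμ.trans_le hc
  have hM₃ : 0 < M₃ := hcpos.trans_le hcM
  have hba : 0 ≤ b * a := by positivity
  have hbφ : 0 ≤ b * φ := by positivity
  -- Every term is compared with b a or b φ. The dissipation (2/M₃) b a absorbs all other multiples
  -- of b a, which carry a factor ε. The unit excess in `hlβ` provides a spare b φ for the part of
  -- the cross term in w that is a multiple of b φ.
  have t1 : 2 / M₃ * (b * a) ≤ 2 * b / c * a := by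
    have : 2 / M₃ ≤ 2 / c := div_le_div_of_nonneg_left (by norm_num) hcpos hcM
    calc _ ≤ 2 / c * (b * a) := mul_le_mul_of_nonneg_right this hba
      _ = _ := by ring
  have t2 : -(ε * (c' / c ^ 2) * a) ≤ ε * (M₄ / μ ^ 2) * (b * a) := by
    have h3 : -(c' / c ^ 2) ≤ M₄ * b / μ ^ 2 := by
      rw [← neg_div]
      exact div_le_div₀ (by positivity) ((neg_le_abs c').trans hc') (by positivity)
        (pow_le_pow_left₀ hμ.le hc 2)
    have := mul_le_mul_of_nonneg_left h3 (mul_nonneg hε.le ha)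
    calc _ = ε * a * -(c' / c ^ 2) := by ring
      _ ≤ _ := this
      _ = _ := by ring
  have t3 : β * b * (ε * (a / c)) ≤ ε * (β / μ) * (b * a) := by
    have h3 : a / c ≤ a / μ := div_le_div_of_nonneg_left ha hμ hc
    have := mul_le_mul_of_nonneg_left h3 (show 0 ≤ β * b * ε by positivity)
    calc _ = β * b * ε * (a / c) := by ring
      _ ≤ _ := this
      _ = _ := by ring
  have hbsq : b ^ 2 * (a + η) ≤ b * a + κ * (b * φ) := by
    have h3 : b ^ 2 * (a + η) ≤ b * (a + η) := by
      refine mul_le_mul_of_nonneg_right ?_ (by positivity)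
      nlinarith
    have h4 : b * η ≤ b * (κ * φ) := mul_le_mul_of_nonneg_left hηφ hb.le
    nlinarith
  have t4 : 2 * w * (b' + β * b ^ 2) ≤ (1 + β) * (b * a + κ * (b * φ)) := by
    have h3 : |b' + β * b ^ 2| ≤ (1 + β) * b ^ 2 := by
      have := sq_nonneg b
      rw [abs_le]
      constructor <;> nlinarith [mul_nonneg hβ (sq_nonneg b)]
    calc _ ≤ |2 * w * (b' + β * b ^ 2)| := le_abs_self _
      _ = |2 * w| * |b' + β * b ^ 2| := abs_mul _ _
      _ ≤ (a + η) * ((1 + β) * b ^ 2) := mul_le_mul hw h3 (abs_nonneg _) (by positivity)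
      _ = (1 + β) * (b ^ 2 * (a + η)) := by ring
      _ ≤ _ := mul_le_mul_of_nonneg_left hbsq (by positivity)
  have t4' := mul_le_mul_of_nonneg_left t4 (mul_nonneg hε.le hl)
  have t5 : l * (b * (2 * μ * φ)) ≤ l * (b * (2 * c * φ)) := by
    refine mul_le_mul_of_nonneg_left (mul_le_mul_of_nonneg_left ?_ hb.le) hl
    nlinarith
  have t6 : l * (b' * (b * η)) ≤ 0 :=
    mul_nonpos_of_nonneg_of_nonpos hl (mul_nonpos_of_nonpos_of_nonneg hb' (by positivity))
  have t7 : β * b * (l * (b * (b * η))) ≤ β * l * q * κ * (b * φ) := by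
    have h3 : b ^ 2 * η ≤ q * (κ * φ) :=
      mul_le_mul hbq hηφ hη ((sq_nonneg b).trans hbq)
    have := mul_le_mul_of_nonneg_left h3 (show 0 ≤ β * b * l by positivity)
    calc _ = β * b * l * (b ^ 2 * η) := by ring
      _ ≤ _ := this
      _ = _ := by ring
  have s1 : ε * (M₄ / μ ^ 2 + 2 * l + β / μ + l * (1 + β)) * (b * a) ≤ 2 / M₃ * (b * a) :=
    mul_le_mul_of_nonneg_right h1 hba
  have s2 : ε * (l * (1 + β) * κ) * (b * φ) ≤ 1 * (b * φ) := mul_le_mul_of_nonneg_right h2 hbφ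
  have s3 : (β + 1) * (b * φ) ≤ l * (2 * μ - β * q * κ) * (b * φ) :=
    mul_le_mul_of_nonneg_right hlβ hbφ
  linarith

/-- The modified energy is equivalent to the energy; here `A = |g|` and `E = |h|`. -/
theorem modified_energy_equiv {b c M₃ κ l ε A φ E w : ℝ} (hb : 0 < b) (hb1 : b ≤ 1)
    (hc : 0 < c) (hcM : c ≤ M₃) (hκ : 0 ≤ κ) (hφ : 0 ≤ φ) (hA : 0 ≤ A) (hE0 : 0 ≤ E) (hE : E ^ 2 ≤ κ * φ)
    (hw : |w| ≤ E * A) (hl : 0 ≤ l) (hε : 0 < ε) (hsmall : ε * (2 * M₃ * l ^ 2 * κ) ≤ 1 / 2) :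
    (ε * (A ^ 2 / c) + φ) / 2 ≤ ε * (A ^ 2 / c) + φ + l * (b * (2 * (ε * w) + b * E ^ 2)) ∧
      ε * (A ^ 2 / c) + φ + l * (b * (2 * (ε * w) + b * E ^ 2)) ≤
        (2 + l * κ) * (ε * (A ^ 2 / c) + φ) := by
  have hM₃ : 0 < M₃ := hc.trans_le hcM
  -- Young's inequality weighted so that the g part costs half of the term A²/c, as c ≤ M₃;
  -- smallness of ε then makes the h part cost at most φ/2.
  have h1 : 2 * (l * b * (E * A)) ≤ A ^ 2 / (2 * M₃) + 2 * M₃ * l ^ 2 * E ^ 2 := by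
    have h3 : 2 * (l * b * (E * A)) ≤ 2 * (l * (E * A)) := by
      have : 0 ≤ l * (E * A) := by positivity
      nlinarith
    have h4 : A ^ 2 / (2 * M₃) + 2 * M₃ * l ^ 2 * E ^ 2 - 2 * (l * (E * A)) =
        (A - 2 * M₃ * l * E) ^ 2 / (2 * M₃) := by field_simp; ring
    have h5 : 0 ≤ (A - 2 * M₃ * l * E) ^ 2 / (2 * M₃) := by positivity
    linarith
  have h2 : A ^ 2 / (2 * M₃) ≤ A ^ 2 / c / 2 := by
    rw [div_div, mul_comm c]
    exact div_le_div_of_nonneg_left (sq_nonneg _) (by positivity) (by linarith)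
  have h3 : ε * (2 * M₃ * l ^ 2 * E ^ 2) ≤ φ / 2 := by
    have h4 := mul_le_mul_of_nonneg_left hE (show 0 ≤ ε * (2 * M₃ * l ^ 2) by positivity)
    have h5 := mul_le_mul_of_nonneg_right hsmall hφ
    nlinarith
  have h4 : |l * (b * (2 * (ε * w)))| ≤ ε * (A ^ 2 / c) / 2 + φ / 2 := by
    have e : l * (b * (2 * (ε * w))) = 2 * ε * (l * b) * w := by ring
    rw [e, abs_mul, abs_of_nonneg (show 0 ≤ 2 * ε * (l * b) by positivity)]
    have h5 := mul_le_mul_of_nonneg_left hw (show 0 ≤ 2 * ε * (l * b) by positivity)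
    have h6 := mul_le_mul_of_nonneg_left (h1.trans (add_le_add_left h2 _)) hε.le
    nlinarith
  have h5 := abs_le.1 h4
  have h6 : 0 ≤ l * (b * (b * E ^ 2)) := by positivity
  have h7 : l * (b * (b * E ^ 2)) ≤ l * κ * φ := by
    have : b * (b * E ^ 2) ≤ E ^ 2 := by
      have hbb : b * b ≤ 1 := by nlinarith
      nlinarith [sq_nonneg E]
    calc _ ≤ l * E ^ 2 := mul_le_mul_of_nonneg_left this hl
      _ ≤ l * (κ * φ) := mul_le_mul_of_nonneg_left hE hl
      _ = _ := by ring
  have h8 : 0 ≤ ε * (A ^ 2 / c) := by positivity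
  have h9 : 0 ≤ l * κ * φ := h6.trans h7
  have h10 : 0 ≤ l * κ * (ε * (A ^ 2 / c)) := by positivity
  constructor <;> nlinarith

theorem IsCoeff.M₄_nonneg {b b' c c' : ℝ → ℝ} {μ M₃ M₄ : ℝ} (hco : IsCoeff b b' c c' μ M₃ M₄) :
    0 ≤ M₄ :=
  nonneg_of_mul_nonneg_left ((abs_nonneg _).trans (hco.abs_c'_le 0 le_rfl)) (hco.b_pos 0 le_rfl)

theorem IsCoeff.M₃_pos {b b' c c' : ℝ → ℝ} {μ M₃ M₄ : ℝ} (hco : IsCoeff b b' c c' μ M₃ M₄) :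
    0 < M₃ :=
  hco.μ_pos.trans_le ((hco.c_lower 0 le_rfl).trans (hco.c_upper 0 le_rfl))

section Energy

variable {b b' c c' : ℝ → ℝ} {μ M₃ M₄ ε : ℝ} {R : H →L[ℝ] H} {f g h : ℝ → H}

/-- Dividing by c, rather than multiplying |f|² by c, puts c' next to ε|g|², where the damping
dominates it for small ε. -/
theorem IsSystemSolution.hasDeriv_energy (hco : IsCoeff b b' c c' μ M₃ M₄) (hε : 0 < ε)
    (hR : ∀ x y, inner ℝ (R x) y = inner ℝ x (R y)) (hs : IsSystemSolution R ε b c f g) (t : ℝ)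
    (ht : 0 ≤ t) :
    HasDerivWithinAt (fun t => ε * (‖g t‖ ^ 2 / c t) + ‖f t‖ ^ 2)
      (-(2 * b t / c t) * ‖g t‖ ^ 2 - ε * (c' t / c t ^ 2) * ‖g t‖ ^ 2) (Ici 0) t := by
  have hc : c t ≠ 0 := (hco.μ_pos.trans_le (hco.c_lower t ht)).ne'
  have h1 := (((hs.hasDeriv_snd t ht).norm_sq.div (hco.hasDeriv_c t ht) hc).const_mul ε).add
    (hs.hasDeriv_fst t ht).norm_sq
  refine h1.congr_deriv ?_
  have e2 : inner ℝ (f t) (R (g t)) = inner ℝ (g t) (R (f t)) := by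
    rw [← hR, real_inner_comm]
  simp only [inner_smul_right, inner_add_right, real_inner_self_eq_norm_sq, e2]
  field_simp
  ring

/-- The summand b|h|² is there to cancel the term -2b⟨h, g⟩ produced by the damping. What remains
contains -2c|f|², the dissipation missing from the energy identity. The outer factor b brings it to
the scale of the rate β b. -/
theorem IsSystemSolution.hasDeriv_modified (hco : IsCoeff b b' c c' μ M₃ M₄) (hε : 0 < ε)
    (hs : IsSystemSolution R ε b c f g)
    (hh : ∀ t, 0 ≤ t → HasDerivWithinAt h (g t) (Ici 0) t)
    (hhR : ∀ t, 0 ≤ t → inner ℝ (h t) (R (f t)) = ‖f t‖ ^ 2) (t : ℝ) (ht : 0 ≤ t) :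
    HasDerivWithinAt (fun t => b t * (2 * (ε * inner ℝ (h t) (g t)) + b t * ‖h t‖ ^ 2))
      (b' t * (2 * (ε * inner ℝ (h t) (g t)) + b t * ‖h t‖ ^ 2) +
        b t * (2 * ε * ‖g t‖ ^ 2 - 2 * c t * ‖f t‖ ^ 2 + b' t * ‖h t‖ ^ 2)) (Ici 0) t := by
  have hb := hco.hasDeriv_b t ht
  have h1 := hb.mul (((((hh t ht).inner ℝ (hs.hasDeriv_snd t ht)).const_mul ε).const_mul 2).add
    (hb.mul (hh t ht).norm_sq))
  refine h1.congr_deriv ?_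
  simp only [inner_smul_right, inner_add_right, real_inner_self_eq_norm_sq, hhR t ht,
    Pi.add_apply, Pi.mul_apply]
  field_simp
  ring

end Energy

/-- Exponential decay of the energy of the system, with constants that are uniform in `ε`, in the
propagation speed and in the operator. -/
theorem exists_energy_decay {b Θ : ℝ → ℝ} {μ M₃ M₄ β κ q T : ℝ} (hM₃ : 0 < M₃) (hM₄ : 0 ≤ M₄)
    (hμ : 0 < μ) (hβ : 0 ≤ β) (hκ : 0 ≤ κ) (hT : 0 ≤ T) (hq : ∀ t, T ≤ t → b t ^ 2 ≤ q)
    (hβq : β * q * κ < 2 * μ)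
    (hΘ : ∀ t, 0 ≤ t → HasDerivWithinAt Θ (b t) (Ici 0) t) :
    ∃ ε₁ : ℝ, 0 < ε₁ ∧ ∃ C : ℝ, 0 ≤ C ∧ ∀ ε ∈ Ioo 0 ε₁, ∀ b' c c' : ℝ → ℝ,
      IsCoeff b b' c c' μ M₃ M₄ → ∀ R : H →L[ℝ] H,
      (∀ x y, inner ℝ (R x) y = inner ℝ x (R y)) → ∀ f g h : ℝ → H,
      IsSystemSolution R ε b c f g →
      (∀ t, 0 ≤ t → HasDerivWithinAt h (g t) (Ici 0) t) →
      (∀ t, 0 ≤ t → inner ℝ (h t) (R (f t)) = ‖f t‖ ^ 2) →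
      (∀ t, 0 ≤ t → ‖h t‖ ^ 2 ≤ κ * ‖f t‖ ^ 2) → ∀ t, 0 ≤ t →
      ε * (‖g t‖ ^ 2 / c t) + ‖f t‖ ^ 2 ≤
        C * (ε * (‖g 0‖ ^ 2 / c 0) + ‖f 0‖ ^ 2) * Real.exp (-β * Θ t) := by
  obtain ⟨l, hl, hlβ⟩ : ∃ l : ℝ, 0 ≤ l ∧ β + 1 ≤ l * (2 * μ - β * q * κ) := by
    have h0 : 0 < 2 * μ - β * q * κ := by linarith
    exact ⟨(β + 1) / (2 * μ - β * q * κ), by positivity, by rw [div_mul_cancel₀ _ h0.ne']⟩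
  let k₁ := M₄ / μ ^ 2 + 2 * l + β / μ + l * (1 + β)
  let k₂ := l * (1 + β) * κ
  let k₃ := 2 * M₃ * l ^ 2 * κ
  have hk₁ : 0 ≤ k₁ := by positivity
  have hk₂ : 0 ≤ k₂ := by positivity
  have hk₃ : 0 ≤ k₃ := by positivity
  have hsmall : ∀ {ε k m : ℝ}, 0 ≤ k → 0 < ε → 0 < m → ε < m / (k + 1) → ε * k ≤ m := by
    intro ε k m hk hε hm h
    rw [lt_div_iff₀ (by positivity)] at h
    nlinarith
  refine ⟨min (min (2 / M₃ / (k₁ + 1)) (1 / (k₂ + 1))) (min (1 / 2 / (k₃ + 1)) (2 * μ / (M₄ + 1))),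
    by positivity, 2 * (2 + l * κ) * Real.exp (β * Θ T), by positivity, ?_⟩
  rintro ε ⟨hε, hε1⟩ b' c c' hco R hR f g h hs hh hhR hhκ t ht
  rw [lt_min_iff, lt_min_iff, lt_min_iff] at hε1
  -- `e1` and `e2` serve the differential inequality, `e3` the equivalence of F and E, and `e4` the
  -- monotonicity of E.
  have e1 := hsmall hk₁ hε (by positivity) hε1.1.1
  have e2 := hsmall hk₂ hε (by positivity) hε1.1.2
  have e3 := hsmall hk₃ hε (by positivity) hε1.2.1
  have e4 := hsmall hM₄ hε (by positivity) hε1.2.2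
  let E : ℝ → ℝ := fun t => ε * (‖g t‖ ^ 2 / c t) + ‖f t‖ ^ 2
  let F : ℝ → ℝ := fun t => E t + l * (b t * (2 * (ε * inner ℝ (h t) (g t)) + b t * ‖h t‖ ^ 2))
  have hcpos : ∀ t, 0 ≤ t → 0 < c t := fun t ht => hμ.trans_le (hco.c_lower t ht)
  have hE0 : ∀ t, 0 ≤ t → 0 ≤ E t := fun t ht => by
    have := hcpos t ht
    simp only [E]; positivity
  have hE := hs.hasDeriv_energy hco hε hR
  have hEmono : ∀ t, 0 ≤ t → E t ≤ E 0 := by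
    intro t ht
    have := le_mul_exp_of_deriv_le (k := 0) hE hΘ ht (fun s hs _ => by
      have hc := hcpos s hs
      have h1 : -(c' s) ≤ M₄ * b s := (neg_le_abs _).trans (hco.abs_c'_le s hs)
      have h2 : 0 ≤ 2 * b s / c s + ε * (c' s / c s ^ 2) := by
        have h3 : 2 * b s / c s + ε * (c' s / c s ^ 2) = (2 * b s * c s + ε * c' s) / c s ^ 2 := by
          field_simp
        rw [h3]
        refine div_nonneg ?_ (sq_nonneg _)
        have h4 := mul_le_mul_of_nonneg_left h1 hε.le
        have h5 := mul_le_mul_of_nonneg_right e4 (hco.b_pos s hs).le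
        have h6 := mul_le_mul_of_nonneg_left (hco.c_lower s hs) (hco.b_pos s hs).le
        nlinarith
      nlinarith [mul_nonneg h2 (sq_nonneg ‖g s‖)])
    simpa using this
  have hequiv : ∀ t, 0 ≤ t → E t / 2 ≤ F t ∧ F t ≤ (2 + l * κ) * E t := fun t ht =>
    modified_energy_equiv (hco.b_pos t ht) (hco.b_le_one t ht) (hcpos t ht) (hco.c_upper t ht) hκ
      (sq_nonneg _) (norm_nonneg _) (norm_nonneg _) (hhκ t ht) (abs_real_inner_le_norm _ _) hl hε e3
  have hΘmono : MonotoneOn Θ (Ici 0) := by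
    refine monotoneOn_of_deriv_nonneg (convex_Ici 0) (fun s hs => (hΘ s hs).continuousWithinAt)
      (fun s hs => ((hΘ s (interior_subset hs)).mono interior_subset).differentiableWithinAt)
      fun s hs => ?_
    rw [interior_Ici] at hs
    rw [((hΘ s (le_of_lt hs)).hasDerivAt (Ici_mem_nhds hs)).deriv]
    exact (hco.b_pos s (le_of_lt hs)).le
  have hlκ : 0 ≤ l * κ := by positivity
  -- Up to time T the bound b² ≤ q is not available; monotonicity of E suffices, at the price of the
  -- factor exp(βΘ(T)) in the constant.
  rcases le_total t T with htT | htT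
  · have h1 : 1 ≤ Real.exp (β * Θ T) * Real.exp (-β * Θ t) := by
      rw [← Real.exp_add]
      refine Real.one_le_exp ?_
      have := mul_le_mul_of_nonneg_left (hΘmono ht hT htT) hβ
      linarith
    have h2 := hE0 0 le_rfl
    calc E t ≤ E 0 := hEmono t ht
      _ ≤ E 0 * (Real.exp (β * Θ T) * Real.exp (-β * Θ t)) := le_mul_of_one_le_right h2 h1
      _ ≤ (2 * (2 + l * κ)) * (E 0 * (Real.exp (β * Θ T) * Real.exp (-β * Θ t))) :=
        le_mul_of_one_le_left (by positivity) (by linarith)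
      _ = _ := by ring
  · have hsub : Ici T ⊆ Ici 0 := Ici_subset_Ici.2 hT
    have hF := fun s (hs0 : 0 ≤ s) => (hE s hs0).add
      ((hs.hasDeriv_modified hco hε hh hhR s hs0).const_mul l)
    have key := le_mul_exp_of_deriv_le (k := β) (a := T)
      (fun s hs => (hF s (hT.trans hs)).mono hsub) (fun s hs => (hΘ s (hT.trans hs)).mono hsub) htT
      (fun s hs _ => by
        have hs0 := hT.trans hs
        have hw : |2 * inner ℝ (h s) (g s)| ≤ ‖g s‖ ^ 2 + ‖h s‖ ^ 2 := by
          rw [abs_mul, abs_two]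
          have := abs_real_inner_le_norm (h s) (g s)
          nlinarith [sq_nonneg (‖h s‖ - ‖g s‖)]
        have := modified_energy_inequality (hco.b_pos s hs0) (hco.b_le_one s hs0) (hq s hs)
          (hco.b'_nonpos s hs0) (hco.neg_sq_le s hs0) hμ (hco.c_lower s hs0) (hco.c_upper s hs0)
          hM₄ (hco.abs_c'_le s hs0) (sq_nonneg ‖h s‖) (hhκ s hs0) (sq_nonneg ‖g s‖)
          (sq_nonneg ‖f s‖) hw hβ hl hε hlβ e1 e2
        refine le_trans (le_of_eq ?_) this
        ring)
    have h1 : F t ≤ F T * Real.exp (-β * (Θ t - Θ T)) := key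
    have h2 : Real.exp (-β * (Θ t - Θ T)) = Real.exp (β * Θ T) * Real.exp (-β * Θ t) := by
      rw [← Real.exp_add]; congr 1; ring
    have h3 : F T ≤ (2 + l * κ) * E 0 := (hequiv T hT).2.trans
      (mul_le_mul_of_nonneg_left (hEmono T hT) (by positivity))
    have h4 := (hequiv t ht).1
    have h5 := mul_le_mul_of_nonneg_right h3 (Real.exp_pos (-β * (Θ t - Θ T))).le
    calc E t ≤ 2 * ((2 + l * κ) * E 0 * Real.exp (-β * (Θ t - Θ T))) := by linarith
      _ = _ := by rw [h2]; ring

/-- Decay of the velocity by comparison. -/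
theorem IsMildPair.norm_velocity_sq_le {S : H →L[ℝ] H} {b b' c c' Θ : ℝ → ℝ} {μ M₃ M₄ ε β C : ℝ}
    (hco : IsCoeff b b' c c' μ M₃ M₄) (hε : 0 < ε) (hβ : ε * β ≤ 1 / 2) (hC : 0 ≤ C)
    (hΘ : ∀ t, 0 ≤ t → HasDerivWithinAt Θ (b t) (Ici 0) t) (hΘ0 : Θ 0 = 0) {f g : ℝ → H}
    (h : IsMildPair S ε b c f g)
    (hf : ∀ t, 0 ≤ t → ‖f t‖ ^ 2 ≤ C * (b t ^ 2 * Real.exp (-β * Θ t))) {t : ℝ} (ht : 0 ≤ t) :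
    ‖S (g t)‖ ^ 2 ≤ (2 * M₃ ^ 2 * C + ‖S (g 0)‖ ^ 2) * Real.exp (-β * Θ t) := by
  set L := 2 * M₃ ^ 2 * C + ‖S (g 0)‖ ^ 2 with hL
  have hL1 : 2 * M₃ ^ 2 * C ≤ L := by rw [hL]; linarith [sq_nonneg ‖S (g 0)‖]
  have hL0 : 0 ≤ L := by positivity
  -- Comparison with the barrier L exp(-βΘ): the difference is nonpositive at time 0 and Grönwall at
  -- rate b/ε keeps it so. The forcing and the derivative of the barrier each use at most half of L
  -- b exp(-βΘ), by the choice of L and by εβ ≤ 1/2.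
  have hZ : ∀ t, 0 ≤ t → HasDerivWithinAt (fun t => ‖S (g t)‖ ^ 2 - L * Real.exp (-β * Θ t))
      (2 * inner ℝ (S (g t)) (-ε⁻¹ • (b t • S (g t) + c t • f t)) -
        L * (Real.exp (-β * Θ t) * (-β * b t))) (Ici 0) t :=
    fun t ht => (h.hasDeriv_snd t ht).norm_sq.sub ((((hΘ t ht).const_mul (-β)).exp).const_mul L)
  have key := le_mul_exp_of_deriv_le (k := ε⁻¹) hZ hΘ ht (fun s hs _ => by
    have hb := hco.b_pos s hs
    have hc := hco.μ_pos.trans_le (hco.c_lower s hs)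
    have hφ := Real.exp_pos (-β * Θ s)
    set φ := Real.exp (-β * Θ s)
    -- Young's inequality with weight b; the resulting 1/b is paid for by the factor b² in `hf`.
    have h1 : -(2 * (c s * inner ℝ (S (g s)) (f s))) ≤
        b s * ‖S (g s)‖ ^ 2 + M₃ ^ 2 * C * (b s * φ) := by
      have h2 : -(2 * (c s * inner ℝ (S (g s)) (f s))) ≤ 2 * (‖S (g s)‖ * (c s * ‖f s‖)) := by
        have := mul_le_mul_of_nonneg_left (abs_le.1 (abs_real_inner_le_norm (S (g s)) (f s))).1 hc.le
        linarith
      have h3 : (c s * ‖f s‖) ^ 2 ≤ M₃ ^ 2 * (C * (b s ^ 2 * φ)) := by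
        rw [mul_pow]
        exact mul_le_mul (pow_le_pow_left₀ hc.le (hco.c_upper s hs) 2) (hf s hs) (sq_nonneg _)
          (sq_nonneg _)
      refine h2.trans (le_of_mul_le_mul_left ?_ hb)
      nlinarith [sq_nonneg (b s * ‖S (g s)‖ - c s * ‖f s‖)]
    have h4 : ε * β * (L * (b s * φ)) ≤ 1 / 2 * (L * (b s * φ)) :=
      mul_le_mul_of_nonneg_right hβ (by positivity)
    have h5 : 2 * M₃ ^ 2 * C * (b s * φ) ≤ L * (b s * φ) :=
      mul_le_mul_of_nonneg_right hL1 (by positivity)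
    refine le_of_mul_le_mul_left ?_ hε
    simp only [inner_smul_right, inner_add_right, real_inner_self_eq_norm_sq]
    have e1 : ε * (2 * (-ε⁻¹ * (b s * ‖S (g s)‖ ^ 2 + c s * inner ℝ (S (g s)) (f s))) -
        L * (φ * (-β * b s))) = -2 * (b s * ‖S (g s)‖ ^ 2) -
          2 * (c s * inner ℝ (S (g s)) (f s)) + ε * β * (L * (b s * φ)) := by
      field_simp
      ring
    have e2 : ε * (-ε⁻¹ * b s * (‖S (g s)‖ ^ 2 - L * φ)) =
        -(b s * ‖S (g s)‖ ^ 2) + L * (b s * φ) := by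
      field_simp
      ring
    rw [e1, e2]
    linarith)
  rw [hΘ0] at key
  simp only [mul_zero, Real.exp_zero, mul_one] at key
  have h1 : (‖S (g 0)‖ ^ 2 - L) * Real.exp (-ε⁻¹ * (Θ t - 0)) ≤ 0 := by
    refine mul_nonpos_of_nonpos_of_nonneg ?_ (Real.exp_pos _).le
    have : 0 ≤ 2 * M₃ ^ 2 * C := by positivity
    rw [hL]; linarith
  linarith

/-- The decay estimates in terms of `f = A u` and `g = A^{1/2} u'`. The rate `β₁` of the energy may
be larger than `β`, which compensates for a damping that tends to zero. -/
theorem IsApprox.exists_decay {S : H →L[ℝ] H} {δ : ℕ → ℝ} {R : ℕ → H →L[ℝ] H}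
    (h : IsApprox S δ R) {ν : ℝ} (hν : 0 < ν)
    (hSν : ∀ x, ν * ‖S x‖ ^ 2 ≤ ‖x‖ ^ 2) {b Θ : ℝ → ℝ} {μ M₃ M₄ β β₁ q T : ℝ} (hM₃ : 0 < M₃)
    (hM₄ : 0 ≤ M₄) (hμ : 0 < μ) (hβ : 0 ≤ β) (hββ : β ≤ β₁) (hT : 0 ≤ T)
    (hq : ∀ t, T ≤ t → b t ^ 2 ≤ q) (hβq : β₁ * q < 2 * μ * ν)
    (hΘ : ∀ t, 0 ≤ t → HasDerivWithinAt Θ (b t) (Ici 0) t) (hΘ0 : Θ 0 = 0)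
    (hb1 : ∀ t, 0 ≤ t → b t ≤ 1) (hb0 : ∀ t, 0 ≤ t → 0 < b t)
    (hexp : ∀ t, 0 ≤ t → Real.exp (-β₁ * Θ t) ≤ b t ^ 2 * Real.exp (-β * Θ t)) (x y : H) :
    ∃ ε₁ : ℝ, 0 < ε₁ ∧ ∃ C : ℝ, 0 ≤ C ∧ ∀ ε ∈ Ioo 0 ε₁, ∀ b' c c' : ℝ → ℝ,
      IsCoeff b b' c c' μ M₃ M₄ → ∀ (f g : ℝ → H) (F G : ℕ → ℝ → H), g 0 = y →
      IsMildPair S ε b c f g → (∀ n, F n 0 = x) → (∀ n, G n 0 = y) →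
      (∀ n, IsSystemSolution (R n) ε b c (F n) (G n)) →
      (∀ t, 0 ≤ t → Tendsto (fun n => F n t) atTop (𝓝 (f t))) →
      (∀ t, 0 ≤ t → Tendsto (fun n => G n t) atTop (𝓝 (g t))) → ∀ t, 0 ≤ t →
      ‖f t‖ ^ 2 + ‖S (g t)‖ ^ 2 + ε * ‖g t‖ ^ 2 ≤ C * Real.exp (-β * Θ t) := by
  have hq0 : 0 ≤ q := (sq_nonneg _).trans (hq T le_rfl)
  have hβ₁ : 0 ≤ β₁ := hβ.trans hββ
  have hβq' : β₁ * q / ν < 2 * μ := by rwa [div_lt_iff₀ hν]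
  -- For h = (S + δ_n) f the best constant available is 1/ν + 2δ_n‖S‖ + δ_n², slightly above 1/ν.
  -- The strict inequality in `hβq` leaves room for such a κ, valid for all large n.
  obtain ⟨κ, hκν, hκ⟩ : ∃ κ, 1 / ν < κ ∧ β₁ * q * κ < 2 * μ := by
    refine ⟨1 / ν + (2 * μ - β₁ * q / ν) / (2 * (β₁ * q + 1)), ?_, ?_⟩
    · have : 0 < (2 * μ - β₁ * q / ν) / (2 * (β₁ * q + 1)) :=
        div_pos (by linarith) (by positivity)
      linarith
    · have h1 : 0 ≤ β₁ * q := by positivity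
      have h2 : β₁ * q * ((2 * μ - β₁ * q / ν) / (2 * (β₁ * q + 1))) <
          2 * μ - β₁ * q / ν := by
        rw [← mul_div_assoc, div_lt_iff₀ (by positivity)]
        nlinarith
      have h3 : β₁ * q * (1 / ν) = β₁ * q / ν := by ring
      rw [mul_add, h3]
      linarith
  have hκ0 : 0 ≤ κ := (by positivity : 0 ≤ 1 / ν).trans hκν.le
  have hev : ∀ᶠ n in atTop, 1 / ν + 2 * δ n * ‖S‖ + δ n ^ 2 < κ := by
    have h1 : Tendsto (fun n => 1 / ν + 2 * δ n * ‖S‖ + δ n ^ 2) atTop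
        (𝓝 (1 / ν + 2 * 0 * ‖S‖ + 0 ^ 2)) :=
      (tendsto_const_nhds.add ((h.tendsto_δ.const_mul 2).mul_const _)).add (h.tendsto_δ.pow 2)
    exact h1.eventually (gt_mem_nhds (by simpa using hκν))
  obtain ⟨ε₁, hε₁, C, hC, hdec⟩ := exists_energy_decay (H := H) hM₃ hM₄ hμ hβ₁ hκ0 hT hq hκ hΘ
  -- The bound 1 makes the initial energy independent of ε; the last bound gives εβ ≤ 1/2 for the
  -- velocity estimate.
  let ε₂ : ℝ := min (min ε₁ 1) (1 / 2 / (β + 1))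
  let E₀ : ℝ := ‖y‖ ^ 2 / μ + ‖x‖ ^ 2
  have hE₀ : 0 ≤ E₀ := by positivity
  let C' : ℝ := C * E₀
  have hC' : 0 ≤ C' := by positivity
  refine ⟨ε₂, by positivity, C' + (2 * M₃ ^ 2 * C' + ‖S y‖ ^ 2) + M₃ * C', by positivity, ?_⟩
  rintro ε ⟨hε, hε2⟩ b' c c' hco f g F G hg0 hfg hF0 hG0 hsol hF hG t ht
  rw [lt_min_iff, lt_min_iff] at hε2
  have hlev : ∀ t, 0 ≤ t → ∀ᶠ n in atTop, ε * (‖G n t‖ ^ 2 / c t) + ‖F n t‖ ^ 2 ≤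
      C' * Real.exp (-β₁ * Θ t) := by
    intro t ht
    filter_upwards [hev] with n hn
    have hRh : ∀ z, R n (S z + δ n • z) = z := by
      intro z
      rw [map_add, map_smul, ← h.comm, h.resolvent]
    refine (hdec ε ⟨hε, hε2.1.1⟩ b' c c' hco (R n) (h.symm n) (F n) (G n)
      (fun t => S (F n t) + δ n • F n t) (hsol n) ?_ ?_ ?_ t ht).trans ?_
    · intro t ht
      have h1 := (hsol n).hasDeriv_fst t ht
      refine ((S.hasFDerivAt.comp_hasDerivWithinAt t h1).add (h1.const_smul (δ n))).congr_deriv ?_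
      exact h.resolvent n _
    · intro t _
      rw [← h.symm, hRh, real_inner_self_eq_norm_sq]
    · intro t _
      have h1 : ‖S (F n t) + δ n • F n t‖ ^ 2 ≤ (‖S (F n t)‖ + δ n * ‖F n t‖) ^ 2 := by
        refine pow_le_pow_left₀ (norm_nonneg _) ((norm_add_le _ _).trans ?_) 2
        rw [norm_smul, Real.norm_eq_abs, abs_of_pos (h.δ_pos n)]
      have h2 : ‖S (F n t)‖ ^ 2 ≤ 1 / ν * ‖F n t‖ ^ 2 := by
        rw [div_mul_eq_mul_div, one_mul, le_div_iff₀ hν, mul_comm]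
        exact hSν _
      have h3 : 2 * δ n * ‖F n t‖ * ‖S (F n t)‖ ≤ 2 * δ n * ‖F n t‖ * (‖S‖ * ‖F n t‖) :=
        mul_le_mul_of_nonneg_left (S.le_opNorm _)
          (mul_nonneg (mul_nonneg zero_le_two (h.δ_pos n).le) (norm_nonneg _))
      have h4 := mul_le_mul_of_nonneg_right hn.le (sq_nonneg ‖F n t‖)
      nlinarith
    · refine mul_le_mul_of_nonneg_right (mul_le_mul_of_nonneg_left ?_ hC) (Real.exp_pos _).le
      rw [hF0, hG0]
      have hc0 := hco.c_lower 0 le_rfl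
      have h1 : ‖y‖ ^ 2 / c 0 ≤ ‖y‖ ^ 2 / μ := div_le_div_of_nonneg_left (sq_nonneg _) hμ hc0
      have h2 : 0 ≤ ‖y‖ ^ 2 / c 0 := div_nonneg (sq_nonneg _) (hμ.le.trans hc0)
      have h3 : ε * (‖y‖ ^ 2 / c 0) ≤ ‖y‖ ^ 2 / c 0 :=
        mul_le_of_le_one_left h2 hε2.1.2.le
      simp only [E₀]
      linarith
  have hlim : ∀ t, 0 ≤ t → ε * (‖g t‖ ^ 2 / c t) + ‖f t‖ ^ 2 ≤ C' * Real.exp (-β₁ * Θ t) :=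
    fun t ht => le_of_tendsto
      (((((hG t ht).norm.pow 2).div_const (c t)).const_mul ε).add ((hF t ht).norm.pow 2)) (hlev t ht)
  have hf : ∀ t, 0 ≤ t → ‖f t‖ ^ 2 ≤ C' * (b t ^ 2 * Real.exp (-β * Θ t)) := by
    intro t ht
    have h1 : 0 ≤ ε * (‖g t‖ ^ 2 / c t) :=
      mul_nonneg hε.le (div_nonneg (sq_nonneg _) (hμ.le.trans (hco.c_lower t ht)))
    have h2 := mul_le_mul_of_nonneg_left (hexp t ht) hC'
    linarith [hlim t ht]
  have hεβ : ε * β ≤ 1 / 2 := by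
    have := hε2.2
    rw [lt_div_iff₀ (by positivity)] at this
    linarith
  have hvel := hfg.norm_velocity_sq_le hco hε hεβ hC' hΘ hΘ0 hf ht
  rw [hg0] at hvel
  have hbexp : Real.exp (-β₁ * Θ t) ≤ Real.exp (-β * Θ t) := by
    refine (hexp t ht).trans (mul_le_of_le_one_left (Real.exp_pos _).le ?_)
    exact pow_le_one₀ (hb0 t ht).le (hb1 t ht)
  have h0 := (hlim t ht).trans (mul_le_mul_of_nonneg_left hbexp hC')
  have hc := hμ.trans_le (hco.c_lower t ht)
  have h1 : 0 ≤ ε * (‖g t‖ ^ 2 / c t) := by positivity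
  have h2 : ε * ‖g t‖ ^ 2 ≤ M₃ * (C' * Real.exp (-β * Θ t)) := by
    calc ε * ‖g t‖ ^ 2 = c t * (ε * (‖g t‖ ^ 2 / c t)) := by field_simp
      _ ≤ M₃ * (C' * Real.exp (-β * Θ t)) :=
        mul_le_mul (hco.c_upper t ht) (by linarith [sq_nonneg ‖f t‖]) h1 hM₃.le
  have h3 : ‖f t‖ ^ 2 ≤ C' * Real.exp (-β * Θ t) := by linarith
  linarith

/-! ### Mild pairs versus global solutions. -/

theorem opVal_eq_of_mem_graph {A : H →ₗ.[ℝ] H} {x y : H} (h : (x, y) ∈ A.graph) :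
    opVal A x = y := by
  have hx := LinearPMap.mem_domain_of_mem_graph h
  unfold opVal
  rw [dif_pos hx]
  exact A.mem_graph_snd_inj (A.mem_graph ⟨x, hx⟩) h rfl

/-- The map y ↦ (P y, y) is bounded into the graph, so regularity in the graph norm is inherited
from the preimage v. -/
theorem contDiffIntoDomain_of_clm {B : H →ₗ.[ℝ] H} {P : H →L[ℝ] H}
    (hP : ∀ y, (P y, y) ∈ B.graph) {k : ℕ} {u v : ℝ → H} (hv : ContDiffOn ℝ k v (Ici 0))
    (huv : ∀ t, 0 ≤ t → u t = P (v t)) : ContDiffIntoDomain k B u := by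
  let J : H →L[ℝ] B.graph := (P.prod (ContinuousLinearMap.id ℝ H)).codRestrict B.graph hP
  exact ⟨fun t => J (v t), J.contDiff.comp_contDiffOn hv, fun t ht => (huv t ht).symm⟩

theorem ContDiffIntoDomain.exists_eq {B : H →ₗ.[ℝ] H} {P : H →L[ℝ] H}
    (hP : ∀ x y, (x, y) ∈ B.graph → x = P y) {k : ℕ} {u : ℝ → H} (h : ContDiffIntoDomain k B u) :
    ∃ v : ℝ → H, ContDiffOn ℝ k v (Ici 0) ∧ ∀ t, 0 ≤ t → u t = P (v t) := by
  obtain ⟨U, hU, hUu⟩ := h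
  refine ⟨fun t => (U t : H × H).2, ?_, fun t ht => ?_⟩
  · exact ((ContinuousLinearMap.snd ℝ H H).comp B.graph.subtypeL).contDiff.comp_contDiffOn hU
  · rw [← hUu t ht]
    exact hP _ _ (U t).2

theorem contDiffOn_one_Ici {v v' : ℝ → H} (h : ∀ t, 0 ≤ t → HasDerivWithinAt v (v' t) (Ici 0) t)
    (hc : ContinuousOn v' (Ici 0)) : ContDiffOn ℝ 1 v (Ici 0) := by
  rw [contDiffOn_one_iff_derivWithin (uniqueDiffOn_Ici 0)]
  exact ⟨fun t ht => (h t ht).differentiableWithinAt, hc.congr fun t ht =>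
    (h t ht).derivWithin (uniqueDiffOn_Ici 0 t ht)⟩

section Correspondence

variable {A : H →ₗ.[ℝ] H} {S : H →L[ℝ] H} {p ε : ℝ} {c : ℝ → ℝ} {u₀ u₁ : H}

theorem IsMildPair.deriv₁_eq {b : ℝ → ℝ} {f g : ℝ → H} (h : IsMildPair S ε b c f g) {t : ℝ}
    (ht : 0 ≤ t) : deriv₁ (fun t => S (S (f t))) t = S (g t) :=
  (S.hasFDerivAt.comp_hasDerivWithinAt t (h.hasDeriv_fst t ht)).derivWithin
    (uniqueDiffOn_Ici 0 t ht)

theorem IsMildPair.isGlobalSolution [CompleteSpace H] (hB : ∀ x y, (x, y) ∈ (sqrtOp A).graph ↔ x = S y)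
    (hA : ∀ x y, (x, y) ∈ A.graph ↔ x = S (S y)) (hε : 0 < ε) {f g : ℝ → H}
    (hcc : ContinuousOn c (Ici 0))
    (h : IsMildPair S ε (fun t => 1 / (1 + t) ^ p) c f g) (hf0 : S (S (f 0)) = u₀)
    (hg0 : S (g 0) = u₁) : IsGlobalSolution A p ε c u₀ u₁ (fun t => S (S (f t))) := by
  have hd2 : ∀ t, 0 ≤ t → deriv₂ (fun t => S (S (f t))) t =
      -ε⁻¹ • ((1 / (1 + t) ^ p) • S (g t) + c t • f t) := by
    intro t ht
    exact ((h.hasDeriv_snd t ht).congr (fun s hs => h.deriv₁_eq hs)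
      (h.deriv₁_eq ht)).derivWithin (uniqueDiffOn_Ici 0 t ht)
  have hbc : ContinuousOn (fun t : ℝ => 1 / (1 + t) ^ p) (Ici 0) := by
    refine continuousOn_const.div ((continuousOn_const.add continuousOn_id).rpow_const ?_) ?_
    · intro t (ht : 0 ≤ t)
      exact Or.inl (by change 1 + t ≠ 0; positivity)
    · intro t (ht : 0 ≤ t)
      positivity
  refine ⟨?_, ?_, ?_, ?_, hf0, ?_⟩
  · have h1 : ContDiffOn ℝ (1 + 1) (fun t => S (S (f t))) (Ici 0) := by
      rw [contDiffOn_succ_iff_derivWithin (uniqueDiffOn_Ici 0)]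
      refine ⟨fun t ht => (S.hasFDerivAt.comp_hasDerivWithinAt t
        (h.hasDeriv_fst t ht)).differentiableWithinAt, by simp, ?_⟩
      refine (contDiffOn_one_Ici h.hasDeriv_snd ?_).congr fun t ht => h.deriv₁_eq ht
      exact ((hbc.smul (S.continuous.comp_continuousOn h.cont_snd)).add
        (hcc.smul h.cont_fst)).const_smul _
    norm_num at h1
    exact h1
  · exact contDiffIntoDomain_of_clm (fun y => (hB _ _).2 rfl)
      (contDiffOn_one_Ici h.hasDeriv_fst h.cont_snd) fun t _ => rfl
  · exact contDiffIntoDomain_of_clm (P := S.comp S) (fun y => (hA _ _).2 rfl)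
      (contDiffOn_zero.2 h.cont_fst) fun t _ => rfl
  · intro t ht
    rw [hd2 t ht, h.deriv₁_eq ht, opVal_eq_of_mem_graph ((hA _ _).2 rfl), smul_smul]
    rw [mul_neg, mul_inv_cancel₀ hε.ne', neg_one_smul]
    abel
  · rw [h.deriv₁_eq le_rfl, hg0]

/-- Regularity into D(A^{1/2}) gives w = S v with v of class C¹, and regularity into D(A) gives w =
S S f with f continuous. Injectivity of S identifies v with S f, and g is the derivative of v. -/
theorem IsGlobalSolution.exists_isMildPair [CompleteSpace H] (hB : ∀ x y, (x, y) ∈ (sqrtOp A).graph ↔ x = S y)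
    (hA : ∀ x y, (x, y) ∈ A.graph ↔ x = S (S y)) (hε : 0 < ε) {w : ℝ → H}
    (h : IsGlobalSolution A p ε c u₀ u₁ w) :
    ∃ f g : ℝ → H, IsMildPair S ε (fun t => 1 / (1 + t) ^ p) c f g ∧
      (∀ t, 0 ≤ t → w t = S (S (f t))) ∧ S (g 0) = u₁ := by
  obtain ⟨v, hv, hwv⟩ := h.contDiff_one.exists_eq (P := S) fun x y => (hB x y).1
  obtain ⟨f, hf, hwf⟩ := h.contDiff_zero.exists_eq (P := S.comp S) fun x y => (hA x y).1
  have hinj : ∀ y, S y = 0 → y = 0 := fun y hy =>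
    (sqrtOp A).graph_fst_eq_zero_snd ((hB (S y) y).2 rfl) hy
  have hvf : ∀ t, 0 ≤ t → v t = S (f t) := by
    intro t ht
    have h1 : S (v t - S (f t)) = 0 := by
      rw [map_sub, sub_eq_zero, ← hwv t ht, hwf t ht]; rfl
    exact sub_eq_zero.1 (hinj _ h1)
  have hv' := (contDiffOn_one_iff_derivWithin (uniqueDiffOn_Ici 0)).1 hv
  let g : ℝ → H := derivWithin v (Ici 0)
  have hvd : ∀ t, 0 ≤ t → HasDerivWithinAt v (g t) (Ici 0) t :=
    fun t ht => (hv'.1 t ht).hasDerivWithinAt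
  have hwd : ∀ t, 0 ≤ t → deriv₁ w t = S (g t) := by
    intro t ht
    exact ((S.hasFDerivAt.comp_hasDerivWithinAt t (hvd t ht)).congr (fun s hs => hwv s hs)
      (hwv t ht)).derivWithin (uniqueDiffOn_Ici 0 t ht)
  have hw1 : ContDiffOn ℝ 1 (deriv₁ w) (Ici 0) := by
    have h2 : ContDiffOn ℝ (1 + 1) w (Ici 0) := by
      norm_num
      exact h.contDiff_two
    exact ((contDiffOn_succ_iff_derivWithin (uniqueDiffOn_Ici 0)).1 h2).2.2
  have hw2 : ∀ t, 0 ≤ t → HasDerivWithinAt (deriv₁ w) (deriv₂ w t) (Ici 0) t := fun t ht =>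
    (((contDiffOn_one_iff_derivWithin (uniqueDiffOn_Ici 0)).1 hw1).1 t ht).hasDerivWithinAt
  refine ⟨f, g, ⟨contDiffOn_zero.1 hf, hv'.2, fun t ht => ?_, fun t ht => ?_⟩, hwf, ?_⟩
  · exact (hvd t ht).congr (fun s hs => (hvf s hs).symm) (hvf t ht).symm
  · refine ((hw2 t ht).congr (fun s hs => (hwd s hs).symm) (hwd t ht).symm).congr_deriv ?_
    have e := h.equation t ht
    have hval : opVal A (w t) = f t := opVal_eq_of_mem_graph ((hA _ _).2 (hwf t ht))
    rw [hwd t ht, hval, add_assoc] at e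
    rw [neg_smul, ← smul_neg, ← eq_neg_of_add_eq_zero_left e, smul_smul,
      inv_mul_cancel₀ hε.ne', one_smul]
  · rw [← hwd 0 le_rfl, h.init_deriv]

theorem Gam_eq [CompleteSpace H] (hB : ∀ x y, (x, y) ∈ (sqrtOp A).graph ↔ x = S y)
    (hA : ∀ x y, (x, y) ∈ A.graph ↔ x = S (S y)) {b : ℝ → ℝ} {f g : ℝ → H}
    (h : IsMildPair S ε b c f g) {t : ℝ} (ht : 0 ≤ t) :
    Gam A ε (fun t => S (S (f t))) t =
      ‖S (S (f t))‖ ^ 2 + ‖S (f t)‖ ^ 2 + ‖f t‖ ^ 2 + ‖S (g t)‖ ^ 2 + ε * ‖g t‖ ^ 2 := by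
  unfold Gam
  rw [h.deriv₁_eq ht, opVal_eq_of_mem_graph ((hB _ _).2 rfl),
    opVal_eq_of_mem_graph ((hA _ _).2 rfl), opVal_eq_of_mem_graph ((hB _ _).2 rfl)]

end Correspondence

/-! ### The damping coefficient (1 + t)^{-p}. -/

/-- The coefficients `b(t) = (1 + t)^{-p}` and `c` satisfy the structural assumptions. -/
theorem isCoeff_rpow {p : ℝ} (hp₀ : 0 ≤ p) (hp₁ : p ≤ 1) {c : ℝ → ℝ} {μ M₃ M₄ : ℝ} (hμ : 0 < μ)
    (hc : ContDiffOn ℝ 1 c (Ici 0)) (hc_lower : ∀ t, 0 ≤ t → μ ≤ c t)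
    (hc_upper : ∀ t, 0 ≤ t → c t ≤ M₃)
    (hc_deriv : ∀ t, 0 ≤ t → |derivWithin c (Ici 0) t| ≤ M₄ / (1 + t) ^ p) :
    IsCoeff (fun t => 1 / (1 + t) ^ p) (fun t => -p * (1 + t) ^ (-p - 1)) c
      (derivWithin c (Ici 0)) μ M₃ M₄ := by
  have hbeq : ∀ t : ℝ, 0 ≤ t → 1 / (1 + t) ^ p = (1 + t) ^ (-p) := by
    intro t ht
    rw [Real.rpow_neg (by positivity), one_div]
  refine ⟨fun t ht => by positivity, fun t ht => ?_, fun t ht => ?_, fun t ht => ?_, fun t ht => ?_,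
    hμ, fun t ht => ?_, hc_lower, hc_upper, fun t ht => ?_⟩
  · rw [div_le_one (by positivity)]
    exact Real.one_le_rpow (by linarith) hp₀
  · have h1 := ((hasDerivAt_id t).const_add 1).rpow_const (p := -p)
      (Or.inl (by simp only [id]; positivity))
    refine (h1.hasDerivWithinAt.congr (fun s hs => hbeq s hs) (hbeq t ht)).congr_deriv ?_
    simp
  · have : 0 ≤ p * (1 + t) ^ (-p - 1) := by positivity
    linarith
  -- Here p ≤ 1 enters: it gives -p - 1 ≤ -2p and bounds the factor p by 1.
  · simp only [hbeq t ht]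
    rw [← Real.rpow_natCast, ← Real.rpow_mul (by positivity)]
    have h1 : (1 + t) ^ (-p - 1) ≤ (1 + t) ^ (-p * (2 : ℕ)) :=
      Real.rpow_le_rpow_of_exponent_le (by linarith) (by push_cast; linarith)
    have h2 : 0 ≤ (1 + t) ^ (-p - 1) := by positivity
    nlinarith
  · exact ((contDiffOn_one_iff_derivWithin (uniqueDiffOn_Ici 0)).1 hc).1 t ht |>.hasDerivWithinAt
  · refine (hc_deriv t ht).trans (le_of_eq ?_)
    rw [mul_one_div]

/-- A damping coefficient with `-b² ≤ b'` decays at most like `exp (-∫ b)`. -/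
theorem IsCoeff.exp_le {b b' c c' Θ : ℝ → ℝ} {μ M₃ M₄ : ℝ} (hco : IsCoeff b b' c c' μ M₃ M₄)
    (hΘ : ∀ t, 0 ≤ t → HasDerivWithinAt Θ (b t) (Ici 0) t) (hΘ0 : Θ 0 = 0) (hb0 : b 0 = 1)
    (β : ℝ) {t : ℝ} (ht : 0 ≤ t) :
    Real.exp (-(β + 2) * Θ t) ≤ b t ^ 2 * Real.exp (-β * Θ t) := by
  -- The Grönwall lemma yields upper bounds, so the lower bound b ≥ exp(-Θ) is obtained from -b.
  have h1 := le_mul_exp_of_deriv_le (k := 1) (Z := fun t => -b t)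
    (fun s hs => (hco.hasDeriv_b s hs).neg) hΘ ht (fun s hs _ => by
      have := hco.neg_sq_le s hs
      nlinarith)
  rw [hΘ0, hb0, sub_zero] at h1
  have h2 : Real.exp (-1 * Θ t) ≤ b t := by linarith
  have h3 := pow_le_pow_left₀ (Real.exp_pos _).le h2 2
  have h4 : Real.exp (-(β + 2) * Θ t) = Real.exp (-1 * Θ t) ^ 2 * Real.exp (-β * Θ t) := by
    rw [← Real.exp_nat_mul, ← Real.exp_add]
    congr 1
    push_cast
    ring
  rw [h4]
  exact mul_le_mul_of_nonneg_right h3 (Real.exp_pos _).le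

end Auxiliary

end HypParab

end

/-! ### Assembly: well-posedness and the three ranges of p. -/

theorem theorem2p9 {H : Type*} [NormedAddCommGroup H] [InnerProductSpace ℝ H] [CompleteSpace H]
    (A : H →ₗ.[ℝ] H) (hdense : Dense (A.domain : Set H)) (hA : IsSelfAdjoint A)
    (ν : ℝ) (hν : 0 < ν) (hcoer : ∀ x : A.domain, ν * ‖(x : H)‖ ^ 2 ≤ inner ℝ (A x) (x : H))
    (p : ℝ) (hp₀ : 0 ≤ p) (hp₁ : p ≤ 1)
    (u₀ u₁ : H) (hu₀ : u₀ ∈ A.domain) (hu₁ : u₁ ∈ (HypParab.sqrtOp A).domain)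
    (ε₀ : ℝ) (hε₀ : 0 < ε₀) (μ M₃ M₄ : ℝ) (hμ : 0 < μ)
    (c : ℝ → ℝ → ℝ)
    (hc : ∀ ε ∈ Ioo 0 ε₀, ContDiffOn ℝ 1 (c ε) (Ici 0))
    (hc_lower : ∀ ε ∈ Ioo 0 ε₀, ∀ t, 0 ≤ t → μ ≤ c ε t)
    (hc_upper : ∀ ε ∈ Ioo 0 ε₀, ∀ t, 0 ≤ t → c ε t ≤ M₃)
    (hc_deriv : ∀ ε ∈ Ioo 0 ε₀, ∀ t, 0 ≤ t →
      |derivWithin (c ε) (Ici 0) t| ≤ M₄ / (1 + t) ^ p) :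
    ∃ u : ℝ → ℝ → H,
      (∀ ε ∈ Ioo 0 ε₀, HypParab.IsGlobalSolution A p ε (c ε) u₀ u₁ (u ε) ∧
        ∀ w : ℝ → H, HypParab.IsGlobalSolution A p ε (c ε) u₀ u₁ w → EqOn w (u ε) (Ici 0)) ∧
      (p = 0 → ∀ β : ℝ, β < 2 * μ * ν → ∃ ε₁ ∈ Ioc 0 ε₀, ∃ C : ℝ,
        ∀ ε ∈ Ioo 0 ε₁, ∀ t, 0 ≤ t →
          HypParab.Gam A ε (u ε) t ≤ C * Real.exp (-β * t)) ∧
      (0 < p → p < 1 → ∀ β : ℝ, 0 < β → ∃ ε₁ ∈ Ioc 0 ε₀, ∃ C : ℝ,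
        ∀ ε ∈ Ioo 0 ε₁, ∀ t, 0 ≤ t →
          HypParab.Gam A ε (u ε) t ≤ C * Real.exp (-β * (1 + t) ^ (1 - p))) ∧
      (p = 1 → ∀ β : ℝ, 0 < β → ∃ ε₁ ∈ Ioc 0 ε₀, ∃ C : ℝ,
        ∀ ε ∈ Ioo 0 ε₁, ∀ t, 0 ≤ t →
          HypParab.Gam A ε (u ε) t ≤ C / (1 + t) ^ β) := by
  obtain ⟨S, hS, hS0, hSν, hB, hA'⟩ := HypParab.exists_inverse_sqrtOp A hdense hA ν hν hcoer
  have hinj : ∀ y, S y = 0 → y = 0 := fun y hy =>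
    (HypParab.sqrtOp A).graph_fst_eq_zero_snd ((hB (S y) y).2 rfl) hy
  have hSd := HypParab.denseRange_of_symmetric S hS hinj
  obtain ⟨δ, R, hR⟩ := HypParab.exists_isApprox S hS hS0
  obtain ⟨x, hx⟩ : ∃ x, S (S x) = u₀ :=
    ⟨A ⟨u₀, hu₀⟩, ((hA' _ _).1 (A.mem_graph ⟨u₀, hu₀⟩)).symm⟩
  obtain ⟨y, hy⟩ : ∃ y, S y = u₁ :=
    ⟨HypParab.sqrtOp A ⟨u₁, hu₁⟩, ((hB _ _).1 ((HypParab.sqrtOp A).mem_graph ⟨u₁, hu₁⟩)).symm⟩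
  let b : ℝ → ℝ := fun t => 1 / (1 + t) ^ p
  have hco : ∀ ε ∈ Ioo 0 ε₀, HypParab.IsCoeff b (fun t => -p * (1 + t) ^ (-p - 1)) (c ε)
      (derivWithin (c ε) (Ici 0)) μ M₃ M₄ := fun ε hε =>
    HypParab.isCoeff_rpow hp₀ hp₁ hμ (hc ε hε) (hc_lower ε hε) (hc_upper ε hε) (hc_deriv ε hε)
  -- Outside (0, ε₀) the families take the junk value 0, so that they can be chosen for all ε at
  -- once.
  have hex : ∀ ε, ∃ (f g : ℝ → H) (F G : ℕ → ℝ → H), ε ∈ Ioo 0 ε₀ →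
      (f 0 = x ∧ g 0 = y ∧ HypParab.IsMildPair S ε b (c ε) f g ∧
      (∀ n, F n 0 = x) ∧ (∀ n, G n 0 = y) ∧
      (∀ n, HypParab.IsSystemSolution (R n) ε b (c ε) (F n) (G n)) ∧
      (∀ t, 0 ≤ t → Filter.Tendsto (fun n => F n t) Filter.atTop (nhds (f t))) ∧
      ∀ t, 0 ≤ t → Filter.Tendsto (fun n => G n t) Filter.atTop (nhds (g t))) := by
    intro ε
    by_cases hε : ε ∈ Ioo 0 ε₀
    · obtain ⟨f, g, F, G, h⟩ := hR.exists_isMildPair hSd (hco ε hε) hε.1 x y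
      exact ⟨f, g, F, G, fun _ => h⟩
    · exact ⟨0, 0, 0, 0, fun h => absurd h hε⟩
  choose f g F G hfg using hex
  -- Any admissible ε would do: it only supplies facts about M₃, M₄ and b, which do not depend on ε.
  have hmid : ε₀ / 2 ∈ Ioo 0 ε₀ := ⟨by linarith, by linarith⟩
  have hM₃ := (hco _ hmid).M₃_pos
  have hM₄ := (hco _ hmid).M₄_nonneg
  have hmain : ∀ (Θ : ℝ → ℝ) (β β₁ q T : ℝ), 0 ≤ β → β ≤ β₁ → 0 ≤ T → (∀ t, T ≤ t → b t ^ 2 ≤ q) →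
      β₁ * q < 2 * μ * ν → (∀ t, 0 ≤ t → HasDerivWithinAt Θ (b t) (Ici 0) t) → Θ 0 = 0 →
      (∀ t, 0 ≤ t → Real.exp (-β₁ * Θ t) ≤ b t ^ 2 * Real.exp (-β * Θ t)) →
      ∃ ε₁ ∈ Ioc 0 ε₀, ∃ C : ℝ, 0 ≤ C ∧ ∀ ε ∈ Ioo 0 ε₁, ∀ t, 0 ≤ t →
        HypParab.Gam A ε (fun t => S (S (f ε t))) t ≤ C * Real.exp (-β * Θ t) := by
    intro Θ β β₁ q T hβ hββ hT hq hβq hΘ hΘ0 hexp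
    obtain ⟨ε₁, hε₁, C, hC, hdec⟩ := hR.exists_decay hν hSν hM₃ hM₄ hμ hβ hββ hT hq hβq hΘ hΘ0
      (hco _ hmid).b_le_one (hco _ hmid).b_pos hexp x y
    refine ⟨min ε₁ ε₀, ⟨lt_min hε₁ hε₀, min_le_right _ _⟩, (1 / ν * (1 / ν) + 1 / ν + 1) * C,
      by positivity, ?_⟩
    rintro ε ⟨hε, hε1⟩ t ht
    rw [lt_min_iff] at hε1
    have hε' : ε ∈ Ioo 0 ε₀ := ⟨hε, hε1.2⟩
    obtain ⟨-, hg0, hm, hF0, hG0, hsol, hF, hG⟩ := hfg ε hε'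
    have key := hdec ε ⟨hε, hε1.1⟩ _ _ _ (hco ε hε') (f ε) (g ε) (F ε) (G ε) hg0 hm hF0 hG0 hsol
      hF hG t ht
    rw [HypParab.Gam_eq hB hA' hm ht, mul_assoc]
    refine le_trans ?_ (mul_le_mul_of_nonneg_left key (by positivity))
    have hS' : ∀ z, ‖S z‖ ^ 2 ≤ 1 / ν * ‖z‖ ^ 2 := by
      intro z
      rw [div_mul_eq_mul_div, one_mul, le_div_iff₀ hν, mul_comm]
      exact hSν z
    have h1 := hS' (f ε t)
    have h2 := (hS' (S (f ε t))).trans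
      (mul_le_mul_of_nonneg_left h1 (show 0 ≤ 1 / ν by positivity))
    have h3 : 0 ≤ (1 / ν * (1 / ν) + 1 / ν) * (‖S (g ε t)‖ ^ 2 + ε * ‖g ε t‖ ^ 2) := by positivity
    linarith
  have hTq : 0 < p → ∀ q : ℝ, 0 < q → ∃ T, 0 ≤ T ∧ ∀ t, T ≤ t → b t ^ 2 ≤ q := by
    intro hp q hq
    have h1 : Filter.Tendsto (fun t : ℝ => 1 + t) Filter.atTop Filter.atTop :=
      Filter.tendsto_atTop_add_const_left _ _ Filter.tendsto_id
    have h2 : Filter.Tendsto (fun t => b t ^ 2) Filter.atTop (nhds (0 ^ 2)) :=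
      (((tendsto_rpow_atTop hp).comp h1).inv_tendsto_atTop.congr fun t => by simp [b]).pow 2
    rw [zero_pow two_ne_zero] at h2
    obtain ⟨T, hT⟩ := Filter.eventually_atTop.1 (h2.eventually (ge_mem_nhds hq))
    exact ⟨max T 0, le_max_right _ _, fun t ht => hT t ((le_max_left _ _).trans ht)⟩
  have hb0 : b 0 = 1 := by simp [b]
  have hpos : 0 < p → ∀ (Θ : ℝ → ℝ) (β : ℝ), 0 ≤ β →
      (∀ t, 0 ≤ t → HasDerivWithinAt Θ (b t) (Ici 0) t) → Θ 0 = 0 →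
      ∃ ε₁ ∈ Ioc 0 ε₀, ∃ C : ℝ, 0 ≤ C ∧ ∀ ε ∈ Ioo 0 ε₁, ∀ t, 0 ≤ t →
        HypParab.Gam A ε (fun t => S (S (f ε t))) t ≤ C * Real.exp (-β * Θ t) := by
    intro hp Θ β hβ hΘ hΘ0
    -- With this q the product (β + 2) q equals μν, below the threshold 2μν whatever β is.
    obtain ⟨T, hT, hq⟩ := hTq hp (μ * ν / (β + 2)) (by positivity)
    refine hmain Θ β (β + 2) _ T hβ (by linarith) hT hq ?_ hΘ hΘ0
      fun t ht => (hco _ hmid).exp_le hΘ hΘ0 hb0 β ht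
    have h1 : 0 < μ * ν := by positivity
    rw [mul_div_cancel₀ _ (by positivity)]
    linarith
  refine ⟨fun ε t => S (S (f ε t)), fun ε hε => ?_, ?_, ?_, ?_⟩
  · obtain ⟨hf0, hg0, hm, -⟩ := hfg ε hε
    refine ⟨hm.isGlobalSolution hB hA' hε.1 (hc ε hε).continuousOn (by rw [hf0, hx])
      (by rw [hg0, hy]), fun w hw t ht => ?_⟩
    obtain ⟨f', g', hm', hw', hg'⟩ := hw.exists_isMildPair hB hA' hε.1
    have h0 : S (f' 0) = S (f ε 0) := by
      refine sub_eq_zero.1 (hinj _ ?_)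
      rw [map_sub, ← hw' 0 le_rfl, hw.init, hf0, hx, sub_self]
    rw [hw' t ht]
    exact congrArg S (hm'.unique hS (hco ε hε) hε.1 hm h0 (by rw [hg', hg0, hy]) ht)
  · rintro rfl β hβ
    have hb : ∀ t, b t = 1 := fun t => by simp [b]
    have hμν : 0 < μ * ν := by positivity
    -- β may be negative, so it is raised to at least μν, still below 2μν. As b = 1, no extra rate
    -- is needed for the velocity.
    obtain ⟨ε₁, hε₁, C, hC, h⟩ := hmain (fun t => t) (max β (μ * ν)) (max β (μ * ν)) 1 0
      (hμν.le.trans (le_max_right _ _)) le_rfl le_rfl (fun t _ => by rw [hb]; norm_num)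
      (by rw [mul_one]; exact max_lt hβ (by linarith))
      (fun t _ => by rw [hb]; exact hasDerivWithinAt_id t _) rfl (fun t _ => by rw [hb]; simp)
    refine ⟨ε₁, hε₁, C, fun ε hε t ht => (h ε hε t ht).trans ?_⟩
    refine mul_le_mul_of_nonneg_left (Real.exp_le_exp.2 ?_) hC
    nlinarith [mul_le_mul_of_nonneg_right (le_max_left β (μ * ν)) ht]
  · intro hp hp1 β hβ
    have h1p : 0 < 1 - p := by linarith
    -- The rate β(1 - p) compensates the denominator of Θ, and the -1 that normalises Θ(0) = 0 costs
    -- the factor exp β in the constant.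
    obtain ⟨ε₁, hε₁, C, hC, h⟩ := hpos hp (fun t => ((1 + t) ^ (1 - p) - 1) / (1 - p))
      (β * (1 - p)) (by positivity) (fun t ht => by
        have h1 := ((((hasDerivAt_id t).const_add 1).rpow_const (p := 1 - p)
          (Or.inl (by change 1 + t ≠ 0; positivity))).sub_const 1).div_const (1 - p)
        refine h1.hasDerivWithinAt.congr_deriv ?_
        have h2 : 1 - p - 1 = -p := by ring
        simp only [id, b, h2]
        rw [Real.rpow_neg (by positivity)]
        field_simp) (by simp)
    refine ⟨ε₁, hε₁, C * Real.exp β, fun ε hε t ht => (h ε hε t ht).trans (le_of_eq ?_)⟩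
    rw [mul_assoc, ← Real.exp_add]
    congr 2
    field_simp
    ring
  · rintro rfl β hβ
    obtain ⟨ε₁, hε₁, C, hC, h⟩ := hpos one_pos (fun t => Real.log (1 + t)) β hβ.le (fun t ht => by
        have h1 := ((hasDerivAt_id t).const_add 1).log (by change 1 + t ≠ 0; positivity)
        refine h1.hasDerivWithinAt.congr_deriv ?_
        simp [b]) (by simp)
    refine ⟨ε₁, hε₁, C, fun ε hε t ht => (h ε hε t ht).trans (le_of_eq ?_)⟩
    have h1 : 0 < 1 + t := by positivity
    rw [div_eq_mul_inv, ← Real.rpow_neg h1.le, Real.rpow_def_of_pos h1]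
    congr 2
    ring
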